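/- **Setting.** For $\mathbf d=(d_1,d_2)\in\mathbb Z^2$ let $\deg\mathbf d=d_1+d_2$; order $\mathbb Z^2$ componentwise and write $\mathbf 1=(1,1)$. A function on $\mathbb Z^2$ is *initially* (resp. *eventually*) *zero* if it vanishes in all sufficiently small (resp. large) degrees. A *Riemann function* is an initially zero $f\colon\mathbb Z^2\to\mathbb Z$ such that for some $C\in\mathbb Z$, $f(\mathbf d)=\deg\mathbf d+C$ for all $\mathbf d$ of sufficiently large degree; its *weight* is the unique initially zero $W\colon\mathbb Z^2\to\mathbb Z$ with $f(\mathbf d)=\sum_{\mathbf d'\le\mathbf d}W(\mathbf d')$. Put $W^*_{\mathbf L}(\mathbf d)=W(\mathbf L-\mathbf d)$. A *perfect matching* is an initially and eventually zero $W$ for which there is a bijection $\pi\colon\mathbb Z\to\mathbb Z$ with $W(i,j)=1$ if $j=\pi(i)$ and $W(i,j)=0$ otherwise. Let $k$ be a field. A *$k$-diagram* $\mathcal F$ consists of $k$-vector spaces $\mathcal F(B_1),\mathcal F(B_2),\mathcal F(B_3),\mathcal F(A_1),\mathcal F(A_2)$ and linear maps $\rho_{ij}\colon\mathcal F(B_i)\to\mathcal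 F(A_j)$ for $(i,j)=(1,1),(2,2),(3,1),(3,2)$; $H^0(\mathcal F)$ and $H^1(\mathcal F)$ are the kernel and cokernel of $$(b_1,b_2,b_3)\mapsto(\rho_{11}b_1-\rho_{31}b_3,\ \rho_{22}b_2-\rho_{32}b_3),$$ and $\mathcal F$ is *Fredholm* if both are finite dimensional. Isomorphisms and direct sums of $k$-diagrams are taken value by value. For a perfect matching $W$ and $\mathbf d\in\mathbb Z^2$, $\mathcal M_{W,\mathbf d}$ is the (Fredholm) $k$-diagram with $B_i$-value $k^{\oplus\mathbb Z_{\le d_i}}$ and $A_i$-value $k^{\oplus\mathbb Z}$ ($i=1,2$), with $\rho_{11},\rho_{22}$ the inclusions, with $B_3$-value $k^{\oplus\{\mathbf a:\,W(\mathbf a)=1\}}$, and with $\rho_{31},\rho_{32}$ induced by the two coordinate projections. A *virtual $k$-diagram* (resp. *virtual $k$-vector space*) is a formal difference $X_1\ominus X_2$ of Fredholm $k$-diagrams (resp. finite-dimensional $k$-vector spaces), where $X_1\ominus X_2$ and $X_3\ominus X_4$ are identified, and called isomorphic, if $X_1\oplus X_4\oplus X_0\simeq X_3\oplus X_2\oplus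 X_0$ for some such $X_0$. Put $H^i(\mathcal F_1\ominus\mathcal F_2)=H^i(\mathcal F_1)\ominus H^i(\mathcal F_2)$ and $(V_1\ominus V_2)^*=V_1^*\ominus V_2^*$. If $$W=(W_1+\cdots+W_s)-(\tilde W_1+\cdots+\tilde W_{s-1})$$ with $s\ge1$ and all $W_i,\tilde W_j$ perfect matchings, then $[\mathcal M_{W,\mathbf d}]$ denotes the class of $$(\mathcal M_{W_1,\mathbf d}\oplus\cdots\oplus\mathcal M_{W_s,\mathbf d})\ominus(\mathcal M_{\tilde W_1,\mathbf d}\oplus\cdots\oplus\mathcal M_{\tilde W_{s-1},\mathbf d}).$$ **Theorem.** Let $W$ be the weight of a Riemann function $\mathbb Z^2\to\mathbb Z$, let $k$ be a field, let $\mathbf d,\mathbf K\in\mathbb Z^2$, and let $\mathbf L=\mathbf K+\mathbf 1$. 1. If $W$ is bounded, then both $W$ and $W^*_{\mathbf L}$ can be written as such a difference of sums of perfect matchings. 2. For every way of writing $W$ and every way of writing $W^*_{\mathbf L}$ as such a difference, there are isomorphisms of virtual $k$-vector spaces $$H^i([\mathcal M_{W,\mathbf d}])^*\ \to\ H^{1-i}([\mathcal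 M_{W^*_{\mathbf L},\mathbf K-\mathbf d}])\qquad(i=0,1).$$ -/

import Mathlib

universe u

namespace RiemannDuality

/-! ### Riemann functions on `ℤ²`, weights, perfect matchings

`ℤ²` is `ℤ × ℤ` with its componentwise order; `1 : ℤ × ℤ` is the vector `(1, 1)`. -/

/-- The degree of an element of `ℤ²`. -/
def deg (d : ℤ × ℤ) : ℤ := d.1 + d.2

/-- `f` vanishes in all sufficiently small degrees. -/
def InitiallyZero (f : ℤ × ℤ → ℤ) : Prop := ∃ a : ℤ, ∀ d, deg d ≤ a → f d = 0

/-- `f` vanishes in all sufficiently large degrees. -/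
def EventuallyZero (f : ℤ × ℤ → ℤ) : Prop := ∃ b : ℤ, ∀ d, b ≤ deg d → f d = 0

/-- Riemann functions `ℤ² → ℤ`. -/
def IsRiemannFunction (f : ℤ × ℤ → ℤ) : Prop :=
  InitiallyZero f ∧ ∃ C b : ℤ, ∀ d, b ≤ deg d → f d = deg d + C

/-- `W` is the weight of `f`: the initially zero function with `f d = ∑_{d' ≤ d} W d'`.
For initially zero `W` this sum has only finitely many nonzero terms. -/
def IsWeightOf (W f : ℤ × ℤ → ℤ) : Prop :=
  InitiallyZero W ∧ ∀ d, f d = ∑ᶠ d' ∈ Set.Iic d, W d'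

/-- The `L`-dual weight `W*_L`. -/
def dualWeight (L : ℤ × ℤ) (W : ℤ × ℤ → ℤ) : ℤ × ℤ → ℤ := fun d => W (L - d)

/-- Perfect matchings. -/
def IsPerfectMatching (W : ℤ × ℤ → ℤ) : Prop :=
  InitiallyZero W ∧ EventuallyZero W ∧
    ∃ π : Equiv.Perm ℤ, ∀ i j : ℤ, W (i, j) = if j = π i then 1 else 0

/-- A way of writing `W = (W₁ + ⋯ + W_{s+1}) - (W̃₁ + ⋯ + W̃_s)` with all `W_i`, `W̃_j` perfect
matchings. -/
structure MatchingDecomposition (W : ℤ × ℤ → ℤ) where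
  s : ℕ
  pos : Fin (s + 1) → (ℤ × ℤ → ℤ)
  neg : Fin s → (ℤ × ℤ → ℤ)
  pos_perfect : ∀ i, IsPerfectMatching (pos i)
  neg_perfect : ∀ j, IsPerfectMatching (neg j)
  eq_sub : ∀ d, W d = ∑ i, pos i d - ∑ j, neg j d

/-! ### Virtual (finite-dimensional) vector spaces -/

section VirtualVectorSpaces

variable (k : Type u) [Field k]

/-- Isomorphism of finite-dimensional `k`-vector spaces. -/
instance vecSetoid : Setoid (FGModuleCat.{u} k) where
  r V W := Nonempty (V ≃ₗ[k] W)
  iseqv :=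
    { refl := fun V => ⟨LinearEquiv.refl k V⟩
      symm := fun ⟨e⟩ => ⟨e.symm⟩
      trans := fun ⟨e⟩ ⟨e'⟩ => ⟨e.trans e'⟩ }

/-- Isomorphism classes of finite-dimensional `k`-vector spaces. -/
def VecClass : Type (u + 1) := Quotient (vecSetoid k)

/-- The isomorphism class of `V`. -/
def VecClass.mk {k : Type u} [Field k] (V : FGModuleCat.{u} k) : VecClass k :=
  Quotient.mk (vecSetoid k) V

/-- Addition is direct sum. -/
instance : Add (VecClass k) where
  add := Quotient.map₂ (fun V W => FGModuleCat.of k (V × W))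
    (fun _ _ ⟨e⟩ _ _ ⟨e'⟩ => ⟨e.prodCongr e'⟩)

instance : Zero (VecClass k) where
  zero := Quotient.mk _ (FGModuleCat.of k PUnit.{u + 1})

instance : AddCommMonoid (VecClass k) where
  add_assoc := by
    rintro ⟨U⟩ ⟨V⟩ ⟨W⟩
    exact Quotient.sound ⟨LinearEquiv.prodAssoc k U V W⟩
  zero_add := by
    rintro ⟨V⟩
    exact Quotient.sound ⟨LinearEquiv.uniqueProd⟩
  add_zero := by
    rintro ⟨V⟩
    exact Quotient.sound ⟨LinearEquiv.prodUnique⟩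
  add_comm := by
    rintro ⟨V⟩ ⟨W⟩
    exact Quotient.sound ⟨LinearEquiv.prodComm k V W⟩
  nsmul := nsmulRec

/-- Equivalence classes of virtual (finite-dimensional) `k`-vector spaces `V₁ ⊖ V₂`: the
Grothendieck group of the monoid of isomorphism classes under direct sum. Its equality is spelled
out in `VirtualSpace.mk_eq_mk_iff`. -/
abbrev VirtualSpace : Type (u + 1) := Algebra.GrothendieckAddGroup (VecClass k)

variable {k}

/-- The class of the virtual vector space `V₁ ⊖ V₂`. -/
noncomputable def VirtualSpace.mk (V₁ V₂ : FGModuleCat.{u} k) : VirtualSpace k :=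
  Algebra.GrothendieckAddGroup.of (VecClass.mk V₁) -
    Algebra.GrothendieckAddGroup.of (VecClass.mk V₂)

theorem grothendieck_sub_eq_sub_iff {M : Type*} [AddCommMonoid M] (a b c d : M) :
    (Algebra.GrothendieckAddGroup.of a - Algebra.GrothendieckAddGroup.of b =
      Algebra.GrothendieckAddGroup.of c - Algebra.GrothendieckAddGroup.of d) ↔
    ∃ e : M, a + d + e = c + b + e := by
  rw [sub_eq_sub_iff_add_eq_add, ← map_add, ← map_add]
  refine ((AddLocalization.addMonoidOf (⊤ : AddSubmonoid M)).eq_iff_exists).trans ?_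
  constructor
  · rintro ⟨e, he⟩
    exact ⟨e, by rw [add_comm _ (e : M), add_comm _ (e : M)]; exact he⟩
  · rintro ⟨e, he⟩
    exact ⟨⟨e, trivial⟩, by rw [add_comm _ e, add_comm _ e] at he; exact he⟩

/-- `V₁ ⊖ V₂` and `V₃ ⊖ V₄` are the same (i.e. isomorphic) as virtual vector spaces iff
`V₁ ⊕ V₄ ⊕ V₀ ≅ V₃ ⊕ V₂ ⊕ V₀` for some finite-dimensional `V₀`. -/
theorem VirtualSpace.mk_eq_mk_iff (V₁ V₂ V₃ V₄ : FGModuleCat.{u} k) :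
    VirtualSpace.mk V₁ V₂ = VirtualSpace.mk V₃ V₄ ↔
      ∃ V₀ : FGModuleCat.{u} k, Nonempty (((V₁ × V₄) × V₀) ≃ₗ[k] ((V₃ × V₂) × V₀)) := by
  refine (grothendieck_sub_eq_sub_iff _ _ _ _).trans ?_
  constructor
  · rintro ⟨⟨V₀⟩, h⟩
    exact ⟨V₀, Quotient.exact h⟩
  · rintro ⟨V₀, h⟩
    exact ⟨Quotient.mk _ V₀, Quotient.sound h⟩

/-- The isomorphism class of `V*`, additively in `V`. -/
noncomputable def VecClass.dual : VecClass k →+ VecClass k where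
  toFun := Quotient.map (fun V => FGModuleCat.of k (Module.Dual k V))
    (fun _ _ ⟨e⟩ => ⟨e.symm.dualMap⟩)
  map_zero' := Quotient.sound ⟨LinearEquiv.ofFinrankEq _ _ (by simp)⟩
  map_add' := by
    rintro ⟨V⟩ ⟨W⟩
    exact Quotient.sound ⟨(Module.dualProdDualEquivDual k V W).symm⟩

/-- The dual of a virtual vector space: `(V₁ ⊖ V₂)* = V₁* ⊖ V₂*`. -/
noncomputable def VirtualSpace.dual : VirtualSpace k →+ VirtualSpace k :=
  Algebra.GrothendieckAddGroup.lift (Algebra.GrothendieckAddGroup.of.comp VecClass.dual)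

theorem VirtualSpace.dual_mk (V₁ V₂ : FGModuleCat.{u} k) :
    VirtualSpace.dual (VirtualSpace.mk V₁ V₂) =
      VirtualSpace.mk (FGModuleCat.of k (Module.Dual k V₁))
        (FGModuleCat.of k (Module.Dual k V₂)) := by
  have h : ∀ x : VecClass k, VirtualSpace.dual (Algebra.GrothendieckAddGroup.of x) =
      Algebra.GrothendieckAddGroup.of (VecClass.dual x) := fun x =>
    DFunLike.congr_fun (Algebra.GrothendieckAddGroup.lift.symm_apply_apply
      (Algebra.GrothendieckAddGroup.of.comp VecClass.dual)) x
  rw [VirtualSpace.mk, map_sub, h, h]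
  rfl

end VirtualVectorSpaces

/-! ### `k`-diagrams -/

/-- A `k`-diagram: five vector spaces `B₁, B₂, B₃, A₁, A₂` and the four restriction maps. -/
structure KDiagram (k : Type u) [Field k] where
  B₁ : ModuleCat.{u} k
  B₂ : ModuleCat.{u} k
  B₃ : ModuleCat.{u} k
  A₁ : ModuleCat.{u} k
  A₂ : ModuleCat.{u} k
  ρ₁₁ : B₁ →ₗ[k] A₁
  ρ₂₂ : B₂ →ₗ[k] A₂
  ρ₃₁ : B₃ →ₗ[k] A₁
  ρ₃₂ : B₃ →ₗ[k] A₂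

namespace KDiagram

variable {k : Type u} [Field k]

/-- The differential
`(b₁, b₂, b₃) ↦ (ρ₁₁ b₁ - ρ₃₁ b₃, ρ₂₂ b₂ - ρ₃₂ b₃)`. -/
def differential (F : KDiagram k) : (F.B₁ × F.B₂ × F.B₃) →ₗ[k] (F.A₁ × F.A₂) where
  toFun b := (F.ρ₁₁ b.1 - F.ρ₃₁ b.2.2, F.ρ₂₂ b.2.1 - F.ρ₃₂ b.2.2)
  map_add' x y := by
    ext <;> simp <;> abel
  map_smul' c x := by
    ext <;> simp [smul_sub]

/-- The cohomology groups: `H⁰` is the kernel and `H¹` the cokernel of the differential. -/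
def H (F : KDiagram k) : Fin 2 → ModuleCat.{u} k
  | 0 => ModuleCat.of k (LinearMap.ker F.differential)
  | 1 => ModuleCat.of k ((F.A₁ × F.A₂) ⧸ LinearMap.range F.differential)

/-- Both Betti numbers are finite. -/
def IsFredholm (F : KDiagram k) : Prop := ∀ i, Module.Finite k (F.H i)

/-- Isomorphisms of `k`-diagrams. -/
structure Iso (F G : KDiagram k) where
  b₁ : F.B₁ ≃ₗ[k] G.B₁
  b₂ : F.B₂ ≃ₗ[k] G.B₂
  b₃ : F.B₃ ≃ₗ[k] G.B₃
  a₁ : F.A₁ ≃ₗ[k] G.A₁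
  a₂ : F.A₂ ≃ₗ[k] G.A₂
  comm₁₁ : ∀ x, G.ρ₁₁ (b₁ x) = a₁ (F.ρ₁₁ x)
  comm₂₂ : ∀ x, G.ρ₂₂ (b₂ x) = a₂ (F.ρ₂₂ x)
  comm₃₁ : ∀ x, G.ρ₃₁ (b₃ x) = a₁ (F.ρ₃₁ x)
  comm₃₂ : ∀ x, G.ρ₃₂ (b₃ x) = a₂ (F.ρ₃₂ x)

/-- The zero diagram. -/
def zero (k : Type u) [Field k] : KDiagram k where
  B₁ := ModuleCat.of k PUnit
  B₂ := ModuleCat.of k PUnit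
  B₃ := ModuleCat.of k PUnit
  A₁ := ModuleCat.of k PUnit
  A₂ := ModuleCat.of k PUnit
  ρ₁₁ := 0
  ρ₂₂ := 0
  ρ₃₁ := 0
  ρ₃₂ := 0

/-- The direct sum of two diagrams. -/
def sum (F G : KDiagram k) : KDiagram k where
  B₁ := ModuleCat.of k (F.B₁ × G.B₁)
  B₂ := ModuleCat.of k (F.B₂ × G.B₂)
  B₃ := ModuleCat.of k (F.B₃ × G.B₃)
  A₁ := ModuleCat.of k (F.A₁ × G.A₁)
  A₂ := ModuleCat.of k (F.A₂ × G.A₂)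
  ρ₁₁ := F.ρ₁₁.prodMap G.ρ₁₁
  ρ₂₂ := F.ρ₂₂.prodMap G.ρ₂₂
  ρ₃₁ := F.ρ₃₁.prodMap G.ρ₃₁
  ρ₃₂ := F.ρ₃₂.prodMap G.ρ₃₂

namespace Iso

def refl (F : KDiagram k) : Iso F F where
  b₁ := LinearEquiv.refl k _
  b₂ := LinearEquiv.refl k _
  b₃ := LinearEquiv.refl k _
  a₁ := LinearEquiv.refl k _
  a₂ := LinearEquiv.refl k _
  comm₁₁ _ := rfl
  comm₂₂ _ := rfl
  comm₃₁ _ := rfl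
  comm₃₂ _ := rfl

def symm {F G : KDiagram k} (e : Iso F G) : Iso G F where
  b₁ := e.b₁.symm
  b₂ := e.b₂.symm
  b₃ := e.b₃.symm
  a₁ := e.a₁.symm
  a₂ := e.a₂.symm
  comm₁₁ x := by rw [LinearEquiv.eq_symm_apply, ← e.comm₁₁, LinearEquiv.apply_symm_apply]
  comm₂₂ x := by rw [LinearEquiv.eq_symm_apply, ← e.comm₂₂, LinearEquiv.apply_symm_apply]
  comm₃₁ x := by rw [LinearEquiv.eq_symm_apply, ← e.comm₃₁, LinearEquiv.apply_symm_apply]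
  comm₃₂ x := by rw [LinearEquiv.eq_symm_apply, ← e.comm₃₂, LinearEquiv.apply_symm_apply]

def trans {F G K : KDiagram k} (e : Iso F G) (e' : Iso G K) : Iso F K where
  b₁ := e.b₁.trans e'.b₁
  b₂ := e.b₂.trans e'.b₂
  b₃ := e.b₃.trans e'.b₃
  a₁ := e.a₁.trans e'.a₁
  a₂ := e.a₂.trans e'.a₂
  comm₁₁ x := by simp [e'.comm₁₁, e.comm₁₁]
  comm₂₂ x := by simp [e'.comm₂₂, e.comm₂₂]
  comm₃₁ x := by simp [e'.comm₃₁, e.comm₃₁]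
  comm₃₂ x := by simp [e'.comm₃₂, e.comm₃₂]

def sumCongr {F G F' G' : KDiagram k} (e : Iso F G) (e' : Iso F' G') :
    Iso (F.sum F') (G.sum G') where
  b₁ := e.b₁.prodCongr e'.b₁
  b₂ := e.b₂.prodCongr e'.b₂
  b₃ := e.b₃.prodCongr e'.b₃
  a₁ := e.a₁.prodCongr e'.a₁
  a₂ := e.a₂.prodCongr e'.a₂
  comm₁₁ x := Prod.ext (e.comm₁₁ x.1) (e'.comm₁₁ x.2)
  comm₂₂ x := Prod.ext (e.comm₂₂ x.1) (e'.comm₂₂ x.2)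
  comm₃₁ x := Prod.ext (e.comm₃₁ x.1) (e'.comm₃₁ x.2)
  comm₃₂ x := Prod.ext (e.comm₃₂ x.1) (e'.comm₃₂ x.2)

def sumAssoc (F G K : KDiagram k) : Iso ((F.sum G).sum K) (F.sum (G.sum K)) where
  b₁ := LinearEquiv.prodAssoc k _ _ _
  b₂ := LinearEquiv.prodAssoc k _ _ _
  b₃ := LinearEquiv.prodAssoc k _ _ _
  a₁ := LinearEquiv.prodAssoc k _ _ _
  a₂ := LinearEquiv.prodAssoc k _ _ _
  comm₁₁ _ := rfl
  comm₂₂ _ := rfl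
  comm₃₁ _ := rfl
  comm₃₂ _ := rfl

def sumComm (F G : KDiagram k) : Iso (F.sum G) (G.sum F) where
  b₁ := LinearEquiv.prodComm k _ _
  b₂ := LinearEquiv.prodComm k _ _
  b₃ := LinearEquiv.prodComm k _ _
  a₁ := LinearEquiv.prodComm k _ _
  a₂ := LinearEquiv.prodComm k _ _
  comm₁₁ _ := rfl
  comm₂₂ _ := rfl
  comm₃₁ _ := rfl
  comm₃₂ _ := rfl

def sumZero (F : KDiagram k) : Iso (F.sum (zero k)) F where
  b₁ := LinearEquiv.prodUnique (R := k) (M := F.B₁) (M₂ := PUnit.{u + 1})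
  b₂ := LinearEquiv.prodUnique (R := k) (M := F.B₂) (M₂ := PUnit.{u + 1})
  b₃ := LinearEquiv.prodUnique (R := k) (M := F.B₃) (M₂ := PUnit.{u + 1})
  a₁ := LinearEquiv.prodUnique (R := k) (M := F.A₁) (M₂ := PUnit.{u + 1})
  a₂ := LinearEquiv.prodUnique (R := k) (M := F.A₂) (M₂ := PUnit.{u + 1})
  comm₁₁ _ := rfl
  comm₂₂ _ := rfl
  comm₃₁ _ := rfl
  comm₃₂ _ := rfl

end Iso

theorem nonempty_H_equiv_of_iso {F G : KDiagram k} (e : Iso F G) (i : Fin 2) :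
    Nonempty (F.H i ≃ₗ[k] G.H i) := by
  have hc : ∀ x, G.differential ((e.b₁.prodCongr (e.b₂.prodCongr e.b₃)) x) =
      (e.a₁.prodCongr e.a₂) (F.differential x) := fun x => by
    ext <;> simp [differential, e.comm₁₁, e.comm₂₂, e.comm₃₁, e.comm₃₂]
  match i with
  | 0 =>
    refine ⟨LinearEquiv.ofSubmodules (e.b₁.prodCongr (e.b₂.prodCongr e.b₃))
      (LinearMap.ker F.differential) (LinearMap.ker G.differential) ?_⟩
    ext y
    rw [Submodule.mem_map]
    constructor
    · rintro ⟨x, hx, rfl⟩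
      have hx' : F.differential x = 0 := hx
      exact (hc x).trans (by rw [hx', map_zero])
    · intro hy
      obtain ⟨x, rfl⟩ := (e.b₁.prodCongr (e.b₂.prodCongr e.b₃)).surjective y
      refine ⟨x, ?_, rfl⟩
      have hy' : (e.a₁.prodCongr e.a₂) (F.differential x) = 0 := (hc x).symm.trans hy
      exact (LinearEquiv.map_eq_zero_iff _).1 hy'
  | 1 =>
    refine ⟨Submodule.Quotient.equiv (LinearMap.range F.differential)
      (LinearMap.range G.differential) (e.a₁.prodCongr e.a₂) ?_⟩
    ext y
    rw [Submodule.mem_map]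
    constructor
    · rintro ⟨_, ⟨x, rfl⟩, rfl⟩
      exact ⟨_, hc x⟩
    · rintro ⟨x, rfl⟩
      obtain ⟨x, rfl⟩ := (e.b₁.prodCongr (e.b₂.prodCongr e.b₃)).surjective x
      exact ⟨_, ⟨x, rfl⟩, (hc x).symm⟩

theorem nonempty_H_sum_equiv (F G : KDiagram k) (i : Fin 2) :
    Nonempty ((F.sum G).H i ≃ₗ[k] (F.H i × G.H i)) := by
  match i with
  | 0 =>
    refine ⟨LinearEquiv.symm (LinearEquiv.ofBijective
      (M := LinearMap.ker F.differential × LinearMap.ker G.differential)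
      (M₂ := LinearMap.ker (F.sum G).differential)
      { toFun := fun p => ⟨((p.1.1.1, p.2.1.1), (p.1.1.2.1, p.2.1.2.1), (p.1.1.2.2, p.2.1.2.2)), by
          have h₁ : F.differential p.1.1 = 0 := p.1.2
          have h₂ : G.differential p.2.1 = 0 := p.2.2
          exact Prod.ext (Prod.ext ((congrArg Prod.fst h₁ :)) ((congrArg Prod.fst h₂ :)))
            (Prod.ext ((congrArg Prod.snd h₁ :)) ((congrArg Prod.snd h₂ :)))⟩
        map_add' := fun _ _ => rfl
        map_smul' := fun _ _ => rfl } ⟨?_, ?_⟩)⟩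
    · rintro ⟨⟨⟨x1, x2, x3⟩, hx⟩, ⟨⟨y1, y2, y3⟩, hy⟩⟩ ⟨⟨⟨u1, u2, u3⟩, hu⟩, ⟨⟨v1, v2, v3⟩, hv⟩⟩ h
      have h' := congrArg Subtype.val h
      have e₁ : x1 = u1 := congrArg (fun z => z.1.1) h'
      have e₂ : y1 = v1 := congrArg (fun z => z.1.2) h'
      have e₃ : x2 = u2 := congrArg (fun z => z.2.1.1) h'
      have e₄ : y2 = v2 := congrArg (fun z => z.2.1.2) h'
      have e₅ : x3 = u3 := congrArg (fun z => z.2.2.1) h'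
      have e₆ : y3 = v3 := congrArg (fun z => z.2.2.2) h'
      subst e₁ e₂ e₃ e₄ e₅ e₆
      rfl
    · rintro ⟨⟨⟨x1, y1⟩, ⟨x2, y2⟩, ⟨x3, y3⟩⟩, h⟩
      have h' : (F.sum G).differential ((x1, y1), (x2, y2), (x3, y3)) = 0 := h
      have e₁ := congrArg (fun z => z.1.1) h'
      have e₂ := congrArg (fun z => z.1.2) h'
      have e₃ := congrArg (fun z => z.2.1) h'
      have e₄ := congrArg (fun z => z.2.2) h'
      exact ⟨⟨⟨(x1, x2, x3), Prod.ext e₁ e₃⟩, ⟨(y1, y2, y3), Prod.ext e₂ e₄⟩⟩, rfl⟩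
  | 1 =>
    let q : ((F.A₁ × G.A₁) × (F.A₂ × G.A₂)) →ₗ[k]
        (((F.A₁ × F.A₂) ⧸ LinearMap.range F.differential) ×
          ((G.A₁ × G.A₂) ⧸ LinearMap.range G.differential)) :=
      { toFun := fun p => (Submodule.Quotient.mk (p.1.1, p.2.1),
          Submodule.Quotient.mk (p.1.2, p.2.2))
        map_add' := fun _ _ => rfl
        map_smul' := fun _ _ => rfl }
    have hq : LinearMap.range (F.sum G).differential = LinearMap.ker q := by
      ext ⟨⟨x1, y1⟩, ⟨x2, y2⟩⟩
      constructor
      · rintro ⟨⟨⟨u1, v1⟩, ⟨u2, v2⟩, ⟨u3, v3⟩⟩, h⟩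
        have e₁ : F.ρ₁₁ u1 - F.ρ₃₁ u3 = x1 := congrArg (fun z => z.1.1) h
        have e₂ : G.ρ₁₁ v1 - G.ρ₃₁ v3 = y1 := congrArg (fun z => z.1.2) h
        have e₃ : F.ρ₂₂ u2 - F.ρ₃₂ u3 = x2 := congrArg (fun z => z.2.1) h
        have e₄ : G.ρ₂₂ v2 - G.ρ₃₂ v3 = y2 := congrArg (fun z => z.2.2) h
        refine Prod.ext ((Submodule.Quotient.mk_eq_zero _).2 ⟨(u1, u2, u3), Prod.ext e₁ e₃⟩)
          ((Submodule.Quotient.mk_eq_zero _).2 ⟨(v1, v2, v3), Prod.ext e₂ e₄⟩)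
      · intro h
        have h' : q ((x1, y1), (x2, y2)) = 0 := h
        obtain ⟨⟨u1, u2, u3⟩, hu⟩ :=
          (Submodule.Quotient.mk_eq_zero _).1 (congrArg Prod.fst h')
        obtain ⟨⟨v1, v2, v3⟩, hv⟩ :=
          (Submodule.Quotient.mk_eq_zero _).1 (congrArg Prod.snd h')
        exact ⟨((u1, v1), (u2, v2), (u3, v3)),
          Prod.ext (Prod.ext ((congrArg Prod.fst hu :)) ((congrArg Prod.fst hv :)))
            (Prod.ext ((congrArg Prod.snd hu :)) ((congrArg Prod.snd hv :)))⟩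
    have hs : Function.Surjective q := by
      rintro ⟨x, y⟩
      obtain ⟨⟨x1, x2⟩, rfl⟩ := Submodule.Quotient.mk_surjective _ x
      obtain ⟨⟨y1, y2⟩, rfl⟩ := Submodule.Quotient.mk_surjective _ y
      exact ⟨((x1, y1), (x2, y2)), rfl⟩
    exact ⟨(Submodule.quotEquivOfEq (LinearMap.range (F.sum G).differential) (LinearMap.ker q)
      hq).trans (q.quotKerEquivOfSurjective hs)⟩

theorem IsFredholm.sum {F G : KDiagram k} (hF : F.IsFredholm) (hG : G.IsFredholm) :
    (F.sum G).IsFredholm := fun i => by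
  obtain ⟨e⟩ := nonempty_H_sum_equiv F G i
  have := hF i
  have := hG i
  exact Module.Finite.equiv e.symm

theorem subsingleton_H_zero (i : Fin 2) : Subsingleton ((zero k).H i) := by
  match i with
  | 0 =>
    change Subsingleton (LinearMap.ker (zero k).differential)
    exact ⟨fun _ _ => Subtype.ext (Prod.ext (Subsingleton.elim (α := PUnit) _ _)
      (Prod.ext (Subsingleton.elim (α := PUnit) _ _) (Subsingleton.elim (α := PUnit) _ _)))⟩
  | 1 =>
    refine ⟨fun x y => ?_⟩
    obtain ⟨x, rfl⟩ := Submodule.Quotient.mk_surjective _ x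
    obtain ⟨y, rfl⟩ := Submodule.Quotient.mk_surjective _ y
    exact congrArg _ (Prod.ext (Subsingleton.elim (α := PUnit) _ _)
      (Subsingleton.elim (α := PUnit) _ _))

theorem isFredholm_zero : (zero k).IsFredholm := fun i => by
  have := subsingleton_H_zero (k := k) i
  infer_instance

end KDiagram

/-! ### Virtual (Fredholm) `k`-diagrams -/

section VirtualDiagrams

variable (k : Type u) [Field k]

/-- Fredholm `k`-diagrams: `k`-diagrams with finite Betti numbers. -/
def FredholmDiagram : Type (u + 1) := {F : KDiagram k // F.IsFredholm}

instance diagramSetoid : Setoid (FredholmDiagram k) where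
  r F G := Nonempty (KDiagram.Iso F.1 G.1)
  iseqv :=
    { refl := fun F => ⟨KDiagram.Iso.refl F.1⟩
      symm := fun ⟨e⟩ => ⟨e.symm⟩
      trans := fun ⟨e⟩ ⟨e'⟩ => ⟨e.trans e'⟩ }

/-- Isomorphism classes of Fredholm `k`-diagrams. -/
def DiagramClass : Type (u + 1) := Quotient (diagramSetoid k)

/-- Addition is direct sum. -/
instance : Add (DiagramClass k) where
  add := Quotient.map₂ (fun F G => (⟨F.1.sum G.1, F.2.sum G.2⟩ : FredholmDiagram k))
    (fun _ _ ⟨e⟩ _ _ ⟨e'⟩ => ⟨e.sumCongr e'⟩)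

instance : Zero (DiagramClass k) where
  zero := Quotient.mk _ ⟨KDiagram.zero k, KDiagram.isFredholm_zero⟩

instance : AddCommMonoid (DiagramClass k) where
  add_assoc := by
    rintro ⟨F⟩ ⟨G⟩ ⟨K⟩
    exact Quotient.sound ⟨KDiagram.Iso.sumAssoc F.1 G.1 K.1⟩
  zero_add := by
    rintro ⟨F⟩
    exact Quotient.sound ⟨(KDiagram.Iso.sumComm _ _).trans (KDiagram.Iso.sumZero F.1)⟩
  add_zero := by
    rintro ⟨F⟩
    exact Quotient.sound ⟨KDiagram.Iso.sumZero F.1⟩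
  add_comm := by
    rintro ⟨F⟩ ⟨G⟩
    exact Quotient.sound ⟨KDiagram.Iso.sumComm F.1 G.1⟩
  nsmul := nsmulRec

/-- Equivalence classes of virtual (Fredholm) `k`-diagrams `F₁ ⊖ F₂`, where `F₁ ⊖ F₂ ∼ F₃ ⊖ F₄`
iff `F₁ ⊕ F₄ ⊕ F₀ ≅ F₃ ⊕ F₂ ⊕ F₀` for some Fredholm `k`-diagram `F₀`. -/
abbrev VirtualDiagram : Type (u + 1) := Algebra.GrothendieckAddGroup (DiagramClass k)

variable {k}

/-- The isomorphism class of `Hⁱ(F)`, additively in `F`. -/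
noncomputable def DiagramClass.H (i : Fin 2) : DiagramClass k →+ VecClass k where
  toFun := Quotient.map (fun F => (⟨F.1.H i, F.2 i⟩ : FGModuleCat.{u} k))
    (fun _ _ ⟨e⟩ => KDiagram.nonempty_H_equiv_of_iso e i)
  map_zero' := Quotient.sound (by
    have := KDiagram.subsingleton_H_zero (k := k) i
    exact ⟨{ toFun := fun _ => PUnit.unit, invFun := fun _ => 0, map_add' := fun _ _ => rfl,
             map_smul' := fun _ _ => rfl, left_inv := fun _ => Subsingleton.elim _ _,
             right_inv := fun _ => rfl }⟩)
  map_add' := by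
    rintro ⟨F⟩ ⟨G⟩
    exact Quotient.sound (KDiagram.nonempty_H_sum_equiv F.1 G.1 i)

/-- The cohomology of a virtual diagram: `Hⁱ(F₁ ⊖ F₂) = Hⁱ(F₁) ⊖ Hⁱ(F₂)`. -/
noncomputable def VirtualDiagram.H (i : Fin 2) : VirtualDiagram k →+ VirtualSpace k :=
  Algebra.GrothendieckAddGroup.lift (Algebra.GrothendieckAddGroup.of.comp (DiagramClass.H i))

end VirtualDiagrams

/-! ### The diagrams `M_{W,d}` -/

/-- The multiset on `ℤ × ℤ` with multiplicities `W` (for `W ≥ 0`): `W a` copies of each `a`. -/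
abbrev Multi (W : ℤ × ℤ → ℤ) : Type := {p : (ℤ × ℤ) × ℕ // 1 ≤ p.2 ∧ (p.2 : ℤ) ≤ W p.1}

/-- The `k`-diagram `M_{W,d}` (for `W ≥ 0`): `B_i = k^{⊕ ℤ_{≤ d_i}}` and `A_i = k^{⊕ ℤ}` with the
inclusions as restriction maps, `B₃ = k^{⊕ W}` with the two projections. -/
noncomputable def diagramM (k : Type u) [Field k] (W : ℤ × ℤ → ℤ) (d : ℤ × ℤ) : KDiagram k where
  B₁ := ModuleCat.of k ({n : ℤ // n ≤ d.1} →₀ k)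
  B₂ := ModuleCat.of k ({n : ℤ // n ≤ d.2} →₀ k)
  B₃ := ModuleCat.of k (Multi W →₀ k)
  A₁ := ModuleCat.of k (ℤ →₀ k)
  A₂ := ModuleCat.of k (ℤ →₀ k)
  ρ₁₁ := Finsupp.lmapDomain k k (fun n => n.1)
  ρ₂₂ := Finsupp.lmapDomain k k (fun n => n.1)
  ρ₃₁ := Finsupp.lmapDomain k k (fun p => p.1.1.1)
  ρ₃₂ := Finsupp.lmapDomain k k (fun p => p.1.1.2)

section Fredholm

variable {k : Type u} [Field k] {W : ℤ × ℤ → ℤ}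

theorem finite_H_zero_diagramM (d : ℤ × ℤ) (h₁ : Function.Injective fun p : Multi W => p.1.1.1)
    (h₂ : Function.Injective fun p : Multi W => p.1.1.2)
    (hfin : Finite {p : Multi W // p.1.1 ≤ d}) :
    Module.Finite k (LinearMap.ker (diagramM k W d).differential) := by
  let φ : LinearMap.ker (diagramM k W d).differential →ₗ[k] ({p : Multi W // p.1.1 ≤ d} → k) :=
    { toFun := fun b p => (show Multi W →₀ k from b.1.2.2) p.1
      map_add' := fun _ _ => rfl
      map_smul' := fun _ _ => rfl }
  refine Module.Finite.of_injective φ ((injective_iff_map_eq_zero φ).2 ?_)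
  rintro ⟨⟨(b₁ : {n : ℤ // n ≤ d.1} →₀ k), (b₂ : {n : ℤ // n ≤ d.2} →₀ k),
    (b₃ : Multi W →₀ k)⟩, hb⟩ h0
  have e₁ : Finsupp.mapDomain (fun n : {n : ℤ // n ≤ d.1} => n.1) b₁ =
      Finsupp.mapDomain (fun p : Multi W => p.1.1.1) b₃ := sub_eq_zero.1 (congrArg Prod.fst hb :)
  have e₂ : Finsupp.mapDomain (fun n : {n : ℤ // n ≤ d.2} => n.1) b₂ =
      Finsupp.mapDomain (fun p : Multi W => p.1.1.2) b₃ := sub_eq_zero.1 (congrArg Prod.snd hb :)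
  have h3 : b₃ = 0 := by
    ext p
    by_cases hp : p.1.1 ≤ d
    · exact congrFun h0 ⟨p, hp⟩
    · rw [Finsupp.coe_zero, Pi.zero_apply]
      by_cases hp1 : p.1.1.1 ≤ d.1
      · have hp2 : ¬ p.1.1.2 ≤ d.2 := fun h => hp ⟨hp1, h⟩
        rw [← Finsupp.mapDomain_apply h₂ b₃ p, ← e₂]
        exact Finsupp.mapDomain_of_notMem_range _ _ (by rintro ⟨n, hn⟩; exact hp2 (hn ▸ n.2))
      · rw [← Finsupp.mapDomain_apply h₁ b₃ p, ← e₁]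
        exact Finsupp.mapDomain_of_notMem_range _ _ (by rintro ⟨n, hn⟩; exact hp1 (hn ▸ n.2))
  subst h3
  rw [Finsupp.mapDomain_zero, ← Finsupp.mapDomain_zero] at e₁ e₂
  have h4 := Finsupp.mapDomain_injective Subtype.val_injective e₁
  have h5 := Finsupp.mapDomain_injective Subtype.val_injective e₂
  subst h4 h5
  rfl

theorem finite_H_one_diagramM (d : ℤ × ℤ) (h₁ : Function.Surjective fun p : Multi W => p.1.1.1)
    (h₂ : Function.Surjective fun p : Multi W => p.1.1.2)
    (hfin : Finite {p : Multi W // d + 1 ≤ p.1.1}) :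
    Module.Finite k (((ℤ →₀ k) × (ℤ →₀ k)) ⧸
      (show Submodule k ((ℤ →₀ k) × (ℤ →₀ k)) from
        LinearMap.range (diagramM k W d).differential)) := by
  let R : Submodule k ((ℤ →₀ k) × (ℤ →₀ k)) := LinearMap.range (diagramM k W d).differential
  change Module.Finite k (_ ⧸ R)
  let ψ : ({p : Multi W // d + 1 ≤ p.1.1} →₀ k) →ₗ[k] ((ℤ →₀ k) × (ℤ →₀ k)) ⧸ R :=
    R.mkQ ∘ₗ LinearMap.inl k _ _ ∘ₗ Finsupp.lmapDomain k k (fun p => p.1.1.1.1)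
  have key : ∀ (p : Multi W) (c : k),
      R.mkQ (Finsupp.single p.1.1.1 c, 0) = - R.mkQ (0, Finsupp.single p.1.1.2 c) := by
    intro p c
    rw [eq_neg_iff_add_eq_zero, ← map_add, Submodule.mkQ_apply, Submodule.Quotient.mk_eq_zero]
    refine ⟨(0, 0, (show Multi W →₀ k from - Finsupp.single p c)), ?_⟩
    change ((Finsupp.lmapDomain k k _ 0 - Finsupp.lmapDomain k k _ (- Finsupp.single p c) : ℤ →₀ k),
      (Finsupp.lmapDomain k k _ 0 - Finsupp.lmapDomain k k _ (- Finsupp.single p c) : ℤ →₀ k)) = _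
    simp only [map_neg, map_zero, Finsupp.lmapDomain_apply, Finsupp.mapDomain_single]
    exact Prod.ext (((zero_sub _).trans (neg_neg _)).trans (add_zero _).symm)
      (((zero_sub _).trans (neg_neg _)).trans (zero_add _).symm)
  have low₁ : ∀ (n : ℤ) (c : k), n ≤ d.1 → R.mkQ (Finsupp.single n c, 0) = 0 := by
    intro n c hn
    rw [Submodule.mkQ_apply, Submodule.Quotient.mk_eq_zero]
    refine ⟨((show {n : ℤ // n ≤ d.1} →₀ k from Finsupp.single ⟨n, hn⟩ c), 0, 0), ?_⟩
    change ((Finsupp.lmapDomain k k _ (Finsupp.single _ c) - Finsupp.lmapDomain k k _ 0 : ℤ →₀ k),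
      (Finsupp.lmapDomain k k _ 0 - Finsupp.lmapDomain k k _ 0 : ℤ →₀ k)) = _
    simp only [map_zero, Finsupp.lmapDomain_apply, Finsupp.mapDomain_single]
    exact Prod.ext (sub_zero _) (sub_zero _)
  have low₂ : ∀ (n : ℤ) (c : k), n ≤ d.2 → R.mkQ (0, Finsupp.single n c) = 0 := by
    intro n c hn
    rw [Submodule.mkQ_apply, Submodule.Quotient.mk_eq_zero]
    refine ⟨(0, (show {n : ℤ // n ≤ d.2} →₀ k from Finsupp.single ⟨n, hn⟩ c), 0), ?_⟩
    change ((Finsupp.lmapDomain k k _ 0 - Finsupp.lmapDomain k k _ 0 : ℤ →₀ k),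
      (Finsupp.lmapDomain k k _ (Finsupp.single _ c) - Finsupp.lmapDomain k k _ 0 : ℤ →₀ k)) = _
    simp only [map_zero, Finsupp.lmapDomain_apply, Finsupp.mapDomain_single]
    exact Prod.ext (sub_zero _) (sub_zero _)
  have g : ∀ (p : Multi W) (c : k), R.mkQ (Finsupp.single p.1.1.1 c, 0) ∈ LinearMap.range ψ := by
    intro p c
    by_cases hp : d + 1 ≤ p.1.1
    · exact ⟨Finsupp.single ⟨p, hp⟩ c, by simp [ψ]⟩
    · have : p.1.1.1 ≤ d.1 ∨ p.1.1.2 ≤ d.2 := by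
        by_contra! h
        exact hp ⟨Int.add_one_le_iff.2 h.1, Int.add_one_le_iff.2 h.2⟩
      rcases this with h | h
      · rw [low₁ _ _ h]
        exact zero_mem _
      · rw [key, low₂ _ _ h, neg_zero]
        exact zero_mem _
  have g₁ : ∀ x : ℤ →₀ k, R.mkQ (x, 0) ∈ LinearMap.range ψ := by
    intro x
    induction x using Finsupp.induction_linear with
    | zero => exact (map_zero R.mkQ).symm ▸ zero_mem _
    | add x y hx hy =>
      have e : R.mkQ (x + y, 0) = R.mkQ (x, 0) + R.mkQ (y, 0) := by
        rw [← map_add, Prod.mk_add_mk, add_zero]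
      exact e ▸ add_mem hx hy
    | single n c =>
      obtain ⟨p, rfl⟩ := h₁ n
      exact g p c
  have g₂ : ∀ x : ℤ →₀ k, R.mkQ (0, x) ∈ LinearMap.range ψ := by
    intro x
    induction x using Finsupp.induction_linear with
    | zero => exact (map_zero R.mkQ).symm ▸ zero_mem _
    | add x y hx hy =>
      have e : R.mkQ (0, x + y) = R.mkQ (0, x) + R.mkQ (0, y) := by
        rw [← map_add, Prod.mk_add_mk, add_zero]
      exact e ▸ add_mem hx hy
    | single n c =>
      obtain ⟨p, rfl⟩ := h₂ n
      have := neg_mem (g p c)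
      rwa [key, neg_neg] at this
  refine Module.Finite.of_surjective ψ fun y => ?_
  obtain ⟨⟨x₁, x₂⟩, rfl⟩ := Submodule.mkQ_surjective R y
  have e : R.mkQ (x₁, x₂) = R.mkQ (x₁, 0) + R.mkQ (0, x₂) := by
    rw [← map_add, Prod.mk_add_mk, add_zero, zero_add]
  exact e ▸ add_mem (g₁ x₁) (g₂ x₂)

theorem IsPerfectMatching.isFredholm_diagramM (hW : IsPerfectMatching W) (d : ℤ × ℤ) :
    (diagramM k W d).IsFredholm := by
  obtain ⟨⟨a, ha⟩, ⟨b, hb⟩, π, hπ⟩ := hW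
  have hp : ∀ p : Multi W, p.1.1.2 = π p.1.1.1 ∧ p.1.2 = 1 := by
    rintro ⟨⟨⟨i, j⟩, m⟩, h1, h2⟩
    have h3 := hπ i j
    simp only at h1 h2 ⊢
    rw [h3] at h2
    split_ifs at h2 with h
    · exact ⟨h, by omega⟩
    · omega
  have hval : ∀ p : Multi W, W p.1.1 ≠ 0 := fun p h => by
    have h1 := p.2.1
    have h2 := p.2.2
    omega
  have inj₁ : Function.Injective fun p : Multi W => p.1.1.1 := by
    intro p q h
    have h' : p.1.1.1 = q.1.1.1 := h
    exact Subtype.ext (Prod.ext (Prod.ext h' (by rw [(hp p).1, (hp q).1, h']))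
      (by rw [(hp p).2, (hp q).2]))
  have inj₂ : Function.Injective fun p : Multi W => p.1.1.2 := by
    intro p q h
    have h' : p.1.1.2 = q.1.1.2 := h
    rw [(hp p).1, (hp q).1] at h'
    exact inj₁ (π.injective h')
  have surj₁ : Function.Surjective fun p : Multi W => p.1.1.1 := fun n =>
    ⟨⟨((n, π n), 1), le_refl _, by simp [hπ]⟩, rfl⟩
  have surj₂ : Function.Surjective fun p : Multi W => p.1.1.2 := fun n =>
    ⟨⟨((π.symm n, n), 1), le_refl _, by simp [hπ]⟩, rfl⟩
  intro i
  match i with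
  | 0 =>
    refine finite_H_zero_diagramM d inj₁ inj₂ ?_
    refine Finite.of_injective
      (fun p : {p : Multi W // p.1.1 ≤ d} => (⟨p.1.1.1.1, ?_⟩ : Set.Icc (a - d.2) d.1))
      (fun p q h => Subtype.ext (inj₁ (congrArg Subtype.val h)))
    have h1 : ¬ deg p.1.1.1 ≤ a := fun h => hval p.1 (ha _ h)
    have h2 := p.2.1
    have h3 := p.2.2
    unfold deg at h1
    exact ⟨by omega, h2⟩
  | 1 =>
    refine finite_H_one_diagramM d surj₁ surj₂ ?_
    refine Finite.of_injective
      (fun p : {p : Multi W // d + 1 ≤ p.1.1} => (⟨p.1.1.1.1, ?_⟩ : Set.Icc d.1 (b - d.2)))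
      (fun p q h => Subtype.ext (inj₁ (congrArg Subtype.val h)))
    have h1 : ¬ b ≤ deg p.1.1.1 := fun h => hval p.1 (hb _ h)
    have h2 : d.1 + 1 ≤ p.1.1.1.1 := p.2.1
    have h3 : d.2 + 1 ≤ p.1.1.1.2 := p.2.2
    unfold deg at h1
    exact ⟨by omega, by omega⟩

end Fredholm

/-- The diagram `M_{W,d}` of a perfect matching `W`, up to isomorphism of Fredholm diagrams. -/
noncomputable def matchingClass (k : Type u) [Field k] {W : ℤ × ℤ → ℤ} (hW : IsPerfectMatching W)
    (d : ℤ × ℤ) : DiagramClass k :=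
  Quotient.mk (diagramSetoid k) ⟨diagramM k W d, hW.isFredholm_diagramM d⟩

/-- The class `[M_{W,d}]` of the virtual `k`-diagram
`(M_{W₁,d} ⊕ ⋯ ⊕ M_{W_{s+1},d}) ⊖ (M_{W̃₁,d} ⊕ ⋯ ⊕ M_{W̃_s,d})`,
for a given way of writing `W = (W₁ + ⋯ + W_{s+1}) - (W̃₁ + ⋯ + W̃_s)`. -/
noncomputable def MatchingDecomposition.virtualDiagram (k : Type u) [Field k] {W : ℤ × ℤ → ℤ}
    (D : MatchingDecomposition W) (d : ℤ × ℤ) : VirtualDiagram k :=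
  Algebra.GrothendieckAddGroup.of (∑ i, matchingClass k (D.pos_perfect i) d) -
    Algebra.GrothendieckAddGroup.of (∑ j, matchingClass k (D.neg_perfect j) d)

end RiemannDuality

/-!
Comparing `f` at `(i, j)` and `(i - 1, j)` in large degree shows that the `i`-th row of `W` sums
to `1`, and by symmetry so does every column. A bounded `W` is negative only in a finite range of
degrees, so adding a large constant on the antidiagonals of those degrees makes it nonnegative. What
is added is a sum of the perfect matchings `j = n - i`, and the resulting nonnegative integer matrix
has constant line sums, hence is also a sum of perfect matchings by Hall's theorem.

A section over `B₃` is a finitely supported function on the points `a` of a perfect matching; it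
comes from `B₁` if it is supported on `a₁ ≤ d₁`, and from `B₂` if it is supported on `a₂ ≤ d₂`. The
intersection and the sum of these two subspaces give `H⁰` and `H¹`, so the Betti numbers of
`M_{W,d}` are the sums of `W` over `a ≤ d` and over `a ≥ d + 1`. The reflection `a ↦ K + 1 - a`
exchanges these two regions for `d` and `K - d`, and virtual vector spaces are determined by their
dimension.
-/

namespace RiemannDuality

/-! ### Matrices with constant line sums -/

section LineSum

open Matrix

variable {α β R : Type*}

/-- All rows and columns of `A` are finitely supported with sum `r`. This is the analogue for
infinite matrices of (multiples of) doubly stochastic matrices. -/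
structure HasLineSum [AddCommMonoid R] (A : Matrix α β R) (r : R) : Prop where
  finite_row : ∀ i, (Function.support fun j => A i j).Finite
  finite_col : ∀ j, (Function.support fun i => A i j).Finite
  finsum_row : ∀ i, ∑ᶠ j, A i j = r
  finsum_col : ∀ j, ∑ᶠ i, A i j = r

namespace HasLineSum

section AddCommMonoid

variable [AddCommMonoid R] {A B : Matrix α β R} {r s : R}

theorem transpose (hA : HasLineSum A r) : HasLineSum Aᵀ r :=
  ⟨hA.finite_col, hA.finite_row, hA.finsum_col, hA.finsum_row⟩

theorem zero : HasLineSum (0 : Matrix α β R) 0 := by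
  constructor <;> simp [Matrix.zero_apply]

theorem add (hA : HasLineSum A r) (hB : HasLineSum B s) : HasLineSum (A + B) (r + s) where
  finite_row i := ((hA.finite_row i).union (hB.finite_row i)).subset (Function.support_add _ _)
  finite_col j := ((hA.finite_col j).union (hB.finite_col j)).subset (Function.support_add _ _)
  finsum_row i := by
    rw [← hA.finsum_row i, ← hB.finsum_row i]
    exact finsum_add_distrib (hA.finite_row i) (hB.finite_row i)
  finsum_col j := by
    rw [← hA.finsum_col j, ← hB.finsum_col j]
    exact finsum_add_distrib (hA.finite_col j) (hB.finite_col j)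

theorem nsmul (hA : HasLineSum A r) (n : ℕ) : HasLineSum (n • A) (n • r) := by
  induction n with
  | zero => simpa only [zero_nsmul] using zero
  | succ n ih => simpa only [succ_nsmul] using ih.add hA

theorem sum {ι : Type*} (s : Finset ι) {A : ι → Matrix α β R} {r : ι → R}
    (hA : ∀ n ∈ s, HasLineSum (A n) (r n)) :
    HasLineSum (∑ n ∈ s, A n) (∑ n ∈ s, r n) := by
  classical
  induction s using Finset.induction_on with
  | empty => simpa only [Finset.sum_empty] using zero
  | insert n s hn ih =>
    simp only [Finset.sum_insert hn]
    exact (hA n (Finset.mem_insert_self n s)).add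
      (ih fun m hm => hA m (Finset.mem_insert_of_mem hm))

end AddCommMonoid

theorem sub [AddCommGroup R] {A B : Matrix α β R} {r s : R} (hA : HasLineSum A r)
    (hB : HasLineSum B s) : HasLineSum (A - B) (r - s) where
  finite_row i := ((hA.finite_row i).union (hB.finite_row i)).subset (Function.support_sub _ _)
  finite_col j := ((hA.finite_col j).union (hB.finite_col j)).subset (Function.support_sub _ _)
  finsum_row i := by
    rw [← hA.finsum_row i, ← hB.finsum_row i]
    exact finsum_sub_distrib (hA.finite_row i) (hB.finite_row i)
  finsum_col j := by
    rw [← hA.finsum_col j, ← hB.finsum_col j]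
    exact finsum_sub_distrib (hA.finite_col j) (hB.finite_col j)

theorem toPEquiv_toMatrix [NonAssocSemiring R] [DecidableEq β] (π : α ≃ β) :
    HasLineSum (π.toPEquiv.toMatrix : Matrix α β R) 1 := by
  have hrow (i : α) (j : β) (hj : j ≠ π i) : (π.toPEquiv.toMatrix : Matrix α β R) i j = 0 := by
    simp [hj.symm]
  have hcol (j : β) (i : α) (hi : i ≠ π.symm j) :
      (π.toPEquiv.toMatrix : Matrix α β R) i j = 0 :=
    hrow i j fun h => hi (by simp [h])
  exact
    { finite_row i := (Set.finite_singleton (π i)).subset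
        (Function.support_subset_iff'.2 (hrow i))
      finite_col j := (Set.finite_singleton (π.symm j)).subset
        (Function.support_subset_iff'.2 (hcol j))
      finsum_row i := (finsum_eq_single _ _ (hrow i)).trans (by simp)
      finsum_col j := (finsum_eq_single _ _ (hcol j)).trans (by simp) }

section Ordered

variable [AddCommMonoid R] [PartialOrder R] [IsOrderedAddMonoid R] {A : Matrix α β R} {r : R}

theorem eq_zero_of_nonneg (h0 : ∀ i j, 0 ≤ A i j) (hA : HasLineSum A 0) : A = 0 := by
  ext i j
  have hle : A i j ≤ 0 := by
    simpa only [hA.finsum_row i] using single_le_finsum j (hA.finite_row i) (h0 i)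
  exact hle.antisymm (h0 i j)

end Ordered

section LinearOrdered

variable [AddCommMonoid R] [LinearOrder R] [IsOrderedCancelAddMonoid R] {A : Matrix α β R} {r : R}

theorem exists_injective (hr : 0 < r) (h0 : ∀ i j, 0 ≤ A i j) (hA : HasLineSum A r) :
    ∃ g : α → β, Function.Injective g ∧ ∀ i, A i (g i) ≠ 0 := by
  classical
  have hall (S : Finset α) : S.card ≤ (S.biUnion fun i => (hA.finite_row i).toFinset).card := by
    set T := S.biUnion fun i => (hA.finite_row i).toFinset with hT
    refine (nsmul_le_nsmul_iff_left hr).1 ?_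
    calc S.card • r = ∑ i ∈ S, ∑ᶠ j, A i j := by simp [hA.finsum_row]
      _ = ∑ i ∈ S, ∑ j ∈ T, A i j := by
        refine Finset.sum_congr rfl fun i hi => finsum_eq_sum_of_support_subset _ fun j hj => ?_
        rw [hT, Finset.mem_coe, Finset.mem_biUnion]
        exact ⟨i, hi, (hA.finite_row i).mem_toFinset.2 hj⟩
      _ = ∑ j ∈ T, ∑ i ∈ S, A i j := Finset.sum_comm
      _ ≤ ∑ j ∈ T, ∑ᶠ i, A i j := by
        refine Finset.sum_le_sum fun j _ => ?_
        rw [finsum_eq_sum_of_support_subset (s := S ∪ (hA.finite_col j).toFinset) (fun i => A i j)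
          fun i hi => Finset.mem_union_right _ ((hA.finite_col j).mem_toFinset.2 hi)]
        exact Finset.sum_le_sum_of_subset_of_nonneg Finset.subset_union_left fun i _ _ => h0 i j
      _ = T.card • r := by simp [hA.finsum_col]
  obtain ⟨g, hg, hgA⟩ := (Finset.all_card_le_biUnion_card_iff_exists_injective _).1 hall
  exact ⟨g, hg, fun i => (hA.finite_row i).mem_toFinset.1 (hgA i)⟩

theorem exists_equiv (hr : 0 < r) (h0 : ∀ i j, 0 ≤ A i j) (hA : HasLineSum A r) :
    ∃ π : α ≃ β, ∀ i, A i (π i) ≠ 0 := by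
  obtain ⟨g, hg, hgA⟩ := hA.exists_injective hr h0
  obtain ⟨g', hg', hgA'⟩ := hA.transpose.exists_injective hr fun j i => h0 i j
  obtain ⟨p, hp, hpA⟩ := Function.Embedding.schroeder_bernstein_of_rel hg hg'
    (fun i j => A i j ≠ 0) hgA hgA'
  exact ⟨Equiv.ofBijective p hp, hpA⟩

end LinearOrdered

theorem exists_eq_sum_toMatrix [DecidableEq β] {A : Matrix α β ℤ} {m : ℕ}
    (h0 : ∀ i j, 0 ≤ A i j) (hA : HasLineSum A (m : ℤ)) :
    ∃ π : Fin m → (α ≃ β), A = ∑ n, (π n).toPEquiv.toMatrix := by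
  induction m generalizing A with
  | zero => exact ⟨Fin.elim0, hA.eq_zero_of_nonneg h0⟩
  | succ m ih =>
    obtain ⟨π, hπ⟩ := hA.exists_equiv (by positivity) h0
    have hsub : HasLineSum (A - (π.toPEquiv.toMatrix : Matrix α β ℤ)) (m : ℤ) := by
      simpa using hA.sub (toPEquiv_toMatrix π)
    have hsub_nonneg (i : α) (j : β) : 0 ≤ (A - (π.toPEquiv.toMatrix : Matrix α β ℤ)) i j := by
      rw [Matrix.sub_apply, PEquiv.toMatrix_toPEquiv_apply, Pi.single_apply, sub_nonneg]
      split_ifs with h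
      · exact Int.add_one_le_iff.2 ((h0 i j).lt_of_ne (h ▸ (hπ i).symm))
      · exact h0 i j
    obtain ⟨σ, hσ⟩ := ih hsub_nonneg hsub
    exact ⟨Fin.cons π σ, by simp [Fin.sum_univ_succ, ← hσ]⟩

end HasLineSum

end LineSum

/-! ### Weights of Riemann functions -/

section Weight

variable {f W : ℤ × ℤ → ℤ}

theorem deg_swap (d : ℤ × ℤ) : deg d.swap = deg d := add_comm _ _

theorem InitiallyZero.comp_swap (hf : InitiallyZero f) : InitiallyZero (f ∘ Prod.swap) :=
  hf.imp fun _ ha d hd => ha _ ((deg_swap d).trans_le hd)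

theorem EventuallyZero.comp_swap (hf : EventuallyZero f) : EventuallyZero (f ∘ Prod.swap) :=
  hf.imp fun _ hb d hd => hb _ (hd.trans_eq (deg_swap d).symm)

theorem IsRiemannFunction.comp_swap (hf : IsRiemannFunction f) :
    IsRiemannFunction (f ∘ Prod.swap) := by
  obtain ⟨h0, C, b, hb⟩ := hf
  refine ⟨h0.comp_swap, C, b, fun d hd => ?_⟩
  rw [Function.comp_apply, hb _ (by rwa [deg_swap]), deg_swap]

theorem IsWeightOf.comp_swap (hW : IsWeightOf W f) :
    IsWeightOf (W ∘ Prod.swap) (f ∘ Prod.swap) := by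
  refine ⟨hW.1.comp_swap, fun d => (hW.2 _).trans ?_⟩
  exact finsum_mem_eq_of_bijOn Prod.swap
    ⟨fun a ha => Prod.swap_le_swap.1 ha, Prod.swap_injective.injOn,
      fun a ha => ⟨a.swap, Prod.swap_le_swap.2 ha, a.swap_swap⟩⟩ fun a _ => by simp

theorem InitiallyZero.finite_Iic_inter_support (hW : InitiallyZero W) (d : ℤ × ℤ) :
    (Set.Iic d ∩ Function.support W).Finite := by
  obtain ⟨a, ha⟩ := hW
  refine (Set.finite_Icc (a - d.2, a - d.1) d).subset fun x hx => ⟨?_, hx.1⟩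
  have hdeg : a < deg x := not_le.1 fun h => hx.2 (ha x h)
  obtain ⟨h₁, h₂⟩ : x.1 ≤ d.1 ∧ x.2 ≤ d.2 := hx.1
  unfold deg at hdeg
  constructor <;> dsimp only <;> linarith

theorem EventuallyZero.finite_Ici_inter_support (hW : EventuallyZero W) (d : ℤ × ℤ) :
    (Set.Ici d ∩ Function.support W).Finite := by
  obtain ⟨b, hb⟩ := hW
  refine (Set.finite_Icc d (b - d.2, b - d.1)).subset fun x hx => ⟨hx.1, ?_⟩
  have hdeg : deg x < b := not_le.1 fun h => hx.2 (hb x h)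
  obtain ⟨h₁, h₂⟩ : d.1 ≤ x.1 ∧ d.2 ≤ x.2 := hx.1
  unfold deg at hdeg
  constructor <;> dsimp only <;> linarith

theorem InitiallyZero.finite_Iic_inter_support_row (hW : InitiallyZero W) (i j : ℤ) :
    (Set.Iic j ∩ Function.support fun j' => W (i, j')).Finite :=
  ((hW.finite_Iic_inter_support (i, j)).preimage (Prod.mk_right_injective i).injOn).subset
    fun _ hx => ⟨⟨le_rfl, hx.1⟩, hx.2⟩

theorem finite_support_row (h0 : InitiallyZero W) (h1 : EventuallyZero W) (i : ℤ) :
    (Function.support fun j => W (i, j)).Finite := by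
  obtain ⟨b, hb⟩ := h1
  refine (h0.finite_Iic_inter_support_row i (b - i)).subset fun j hj => ⟨?_, hj⟩
  have hdeg : deg (i, j) < b := not_le.1 fun h => hj (hb _ h)
  unfold deg at hdeg
  rw [Set.mem_Iic]
  linarith

theorem IsWeightOf.sub_eq_finsum_row (hW : IsWeightOf W f) (i j : ℤ) :
    f (i + 1, j) - f (i, j) = ∑ᶠ j' ∈ Set.Iic j, W (i + 1, j') := by
  have hIic : Set.Iic (i + 1, j) = Prod.mk (i + 1) '' Set.Iic j ∪ Set.Iic (i, j) := by
    rw [Set.Iic_prod_eq, Set.Iic_prod_eq, ← Set.insert_prod]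
    exact congrArg (· ×ˢ Set.Iic j) (Order.Iic_succ i)
  have hdisj : Disjoint (Prod.mk (i + 1) '' Set.Iic j) (Set.Iic (i, j)) := by
    rw [Set.disjoint_left]
    rintro _ ⟨_, _, rfl⟩ ⟨h, _⟩
    exact (lt_add_one i).not_ge h
  have hfin := hW.1.finite_Iic_inter_support (i + 1, j)
  rw [hIic, Set.union_inter_distrib_right, Set.finite_union] at hfin
  rw [hW.2, hW.2, hIic, finsum_mem_union' hdisj hfin.1 hfin.2, add_sub_cancel_right,
    finsum_mem_image (Prod.mk_right_injective (i + 1)).injOn]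

theorem IsWeightOf.exists_finsum_row_Iic_eq_one (hf : IsRiemannFunction f) (hW : IsWeightOf W f) :
    ∃ b : ℤ, ∀ i j, b ≤ i + j → ∑ᶠ j' ∈ Set.Iic j, W (i, j') = 1 := by
  obtain ⟨_, C, b, hb⟩ := hf
  refine ⟨b + 1, fun i j hij => ?_⟩
  have h := hW.sub_eq_finsum_row (i - 1) j
  rw [sub_add_cancel] at h
  rw [← h, hb _ (by unfold deg; linarith), hb _ (by unfold deg; linarith)]
  unfold deg
  ring

theorem IsWeightOf.eventuallyZero (hf : IsRiemannFunction f) (hW : IsWeightOf W f) :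
    EventuallyZero W := by
  obtain ⟨b, hb⟩ := hW.exists_finsum_row_Iic_eq_one hf
  refine ⟨b + 1, fun ⟨i, j⟩ hd => ?_⟩
  unfold deg at hd
  have hIic : Set.Iic j = insert j (Set.Iic (j - 1)) := by
    simpa using Order.Iic_succ (j - 1)
  have hrow := hb i j (by linarith)
  rw [hIic, finsum_mem_insert' _ (by simp) (hW.1.finite_Iic_inter_support_row i _),
    hb i (j - 1) (by linarith)] at hrow
  linarith

theorem IsWeightOf.finsum_row (hf : IsRiemannFunction f) (hW : IsWeightOf W f) (i : ℤ) :
    ∑ᶠ j, W (i, j) = 1 := by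
  obtain ⟨b, hb⟩ := hW.exists_finsum_row_Iic_eq_one hf
  obtain ⟨j₀, hj₀⟩ := (finite_support_row hW.1 (hW.eventuallyZero hf) i).bddAbove
  set j := max j₀ (b - i)
  rw [← hb i j (by linarith [le_max_right j₀ (b - i)]), ← finsum_mem_univ]
  refine finsum_mem_inter_support_eq' _ _ _ fun j' hj' => ?_
  simp only [Set.mem_univ, Set.mem_Iic, true_iff]
  exact (hj₀ hj').trans (le_max_left _ _)

theorem IsWeightOf.hasLineSum (hf : IsRiemannFunction f) (hW : IsWeightOf W f) :
    HasLineSum (Matrix.of (Function.curry W)) 1 where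
  finite_row := finite_support_row hW.1 (hW.eventuallyZero hf)
  finite_col := finite_support_row hW.1.comp_swap (hW.eventuallyZero hf).comp_swap
  finsum_row := hW.finsum_row hf
  finsum_col := hW.comp_swap.finsum_row hf.comp_swap

end Weight

/-! ### Decomposition into perfect matchings -/

section Decomposition

variable {W : ℤ × ℤ → ℤ}

theorem InitiallyZero.of_nonneg_of_le {V : ℤ × ℤ → ℤ} (hW : InitiallyZero W) (hV : 0 ≤ V)
    (hVW : V ≤ W) : InitiallyZero V :=
  hW.imp fun _ ha d hd => le_antisymm ((hVW d).trans (ha d hd).le) (hV d)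

theorem EventuallyZero.of_nonneg_of_le {V : ℤ × ℤ → ℤ} (hW : EventuallyZero W) (hV : 0 ≤ V)
    (hVW : V ≤ W) : EventuallyZero V :=
  hW.imp fun _ hb d hd => le_antisymm ((hVW d).trans (hb d hd).le) (hV d)

theorem InitiallyZero.add {V : ℤ × ℤ → ℤ} (hW : InitiallyZero W) (hV : InitiallyZero V) :
    InitiallyZero (W + V) := by
  obtain ⟨a, ha⟩ := hW
  obtain ⟨a', ha'⟩ := hV
  refine ⟨min a a', fun d hd => ?_⟩
  rw [Pi.add_apply, ha d (hd.trans (min_le_left _ _)), ha' d (hd.trans (min_le_right _ _)),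
    add_zero]

theorem EventuallyZero.add {V : ℤ × ℤ → ℤ} (hW : EventuallyZero W) (hV : EventuallyZero V) :
    EventuallyZero (W + V) := by
  obtain ⟨b, hb⟩ := hW
  obtain ⟨b', hb'⟩ := hV
  refine ⟨max b b', fun d hd => ?_⟩
  rw [Pi.add_apply, hb d ((le_max_left _ _).trans hd), hb' d ((le_max_right _ _).trans hd),
    add_zero]

theorem exists_eq_sum_perfectMatching (h0 : InitiallyZero W) (h1 : EventuallyZero W)
    (hW0 : 0 ≤ W) {m : ℕ} (hW : HasLineSum (Matrix.of (Function.curry W)) (m : ℤ)) :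
    ∃ M : Fin m → (ℤ × ℤ → ℤ), (∀ n, IsPerfectMatching (M n)) ∧ W = ∑ n, M n := by
  obtain ⟨π, hπ⟩ := hW.exists_eq_sum_toMatrix fun i j => hW0 (i, j)
  set M : Fin m → (ℤ × ℤ → ℤ) := fun n d => if d.2 = π n d.1 then 1 else 0 with hM
  have hsum : W = ∑ n, M n := by
    ext ⟨i, j⟩
    simpa [Matrix.sum_apply, hM, eq_comm] using congrFun₂ hπ i j
  have hM0 (n : Fin m) : 0 ≤ M n := fun d => by
    simp only [hM, Pi.zero_apply]
    split_ifs <;> norm_num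
  have hMW (n : Fin m) : M n ≤ W :=
    hsum ▸ Finset.single_le_sum (fun n _ => hM0 n) (Finset.mem_univ n)
  exact ⟨M, fun n => ⟨h0.of_nonneg_of_le (hM0 n) (hMW n), h1.of_nonneg_of_le (hM0 n) (hMW n),
    π n, fun _ _ => rfl⟩, hsum⟩

/-- The function with value `c` in the degrees strictly between `a` and `b`, and `0` elsewhere. -/
noncomputable def band (a b : ℤ) (c : ℕ) : ℤ × ℤ → ℤ :=
  fun d => if deg d ∈ Finset.Ioo a b then c else 0

theorem band_nonneg (a b : ℤ) (c : ℕ) : 0 ≤ band a b c := fun d => by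
  unfold band
  split_ifs <;> simp

theorem initiallyZero_band (a b : ℤ) (c : ℕ) : InitiallyZero (band a b c) :=
  ⟨a, fun _ hd => if_neg fun h => (Finset.mem_Ioo.1 h).1.not_ge hd⟩

theorem eventuallyZero_band (a b : ℤ) (c : ℕ) : EventuallyZero (band a b c) :=
  ⟨b, fun _ hd => if_neg fun h => (Finset.mem_Ioo.1 h).2.not_ge hd⟩

theorem hasLineSum_band (a b : ℤ) (c : ℕ) :
    HasLineSum (Matrix.of (Function.curry (band a b c)))
      ((c * (Finset.Ioo a b).card : ℕ) : ℤ) := by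
  have hband : Matrix.of (Function.curry (band a b c)) =
      c • ∑ n ∈ Finset.Ioo a b, (Equiv.subLeft n).toPEquiv.toMatrix := by
    ext i j
    have hj (n : ℤ) : n - i = j ↔ deg (i, j) = n := by
      rw [sub_eq_iff_eq_add', eq_comm, deg]
    simp [Matrix.sum_apply, hj, band]
  rw [hband, Nat.cast_mul, ← nsmul_eq_mul, Finset.cast_card]
  exact (HasLineSum.sum _ fun n _ => HasLineSum.toPEquiv_toMatrix (Equiv.subLeft n)).nsmul c

theorem exists_add_band_nonneg (h0 : InitiallyZero W) (h1 : EventuallyZero W)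
    (hbdd : BddBelow (Set.range W)) : ∃ a b c, 0 ≤ W + band a b c := by
  obtain ⟨a, ha⟩ := h0
  obtain ⟨b, hb⟩ := h1
  obtain ⟨c, hc⟩ := hbdd
  refine ⟨a, b, c.natAbs, fun d => ?_⟩
  rw [Pi.add_apply, band]
  split_ifs with hd
  · have hcd : c ≤ W d := hc (Set.mem_range_self d)
    change 0 ≤ W d + (c.natAbs : ℤ)
    omega
  · rw [Finset.mem_Ioo, not_and_or, not_lt, not_lt] at hd
    exact (hd.elim (ha d) (hb d)).symm.le.trans_eq (add_zero _).symm

theorem nonempty_matchingDecomposition (h0 : InitiallyZero W) (h1 : EventuallyZero W)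
    (hbdd : BddBelow (Set.range W)) (hW : HasLineSum (Matrix.of (Function.curry W)) 1) :
    Nonempty (MatchingDecomposition W) := by
  obtain ⟨a, b, c, hWc⟩ := exists_add_band_nonneg h0 h1 hbdd
  have hadd : HasLineSum (Matrix.of (Function.curry (W + band a b c)))
      ((c * (Finset.Ioo a b).card + 1 : ℕ) : ℤ) := by
    rw [Nat.cast_succ, add_comm (Nat.cast _)]
    exact hW.add (hasLineSum_band a b c)
  obtain ⟨P, hP, hPsum⟩ := exists_eq_sum_perfectMatching (h0.add (initiallyZero_band a b c))
    (h1.add (eventuallyZero_band a b c)) hWc hadd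
  obtain ⟨N, hN, hNsum⟩ := exists_eq_sum_perfectMatching (initiallyZero_band a b c)
    (eventuallyZero_band a b c) (band_nonneg a b c) (hasLineSum_band a b c)
  refine ⟨⟨_, P, N, hP, hN, fun d => ?_⟩⟩
  rw [← Finset.sum_apply, ← Finset.sum_apply, ← hPsum, ← hNsum, Pi.add_apply,
    add_sub_cancel_right]

theorem IsPerfectMatching.dualWeight (hW : IsPerfectMatching W) (L : ℤ × ℤ) :
    IsPerfectMatching (dualWeight L W) := by
  obtain ⟨⟨a, ha⟩, ⟨b, hb⟩, π, hπ⟩ := hW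
  have hdeg (d : ℤ × ℤ) : deg (L - d) = deg L - deg d := by
    simp only [deg, Prod.fst_sub, Prod.snd_sub]
    ring
  refine ⟨⟨deg L - b, fun d hd => hb _ ?_⟩, ⟨deg L - a, fun d hd => ha _ ?_⟩,
    ((Equiv.subLeft L.1).trans π).trans (Equiv.subLeft L.2), fun i j => ?_⟩
  · linarith [hdeg d]
  · linarith [hdeg d]
  · refine (hπ _ _).trans (if_congr ?_ rfl rfl)
    rw [Equiv.trans_apply, Equiv.trans_apply, Equiv.subLeft_apply, Equiv.subLeft_apply,
      sub_eq_iff_eq_add, eq_sub_iff_add_eq', eq_comm]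

/-- The decomposition of the dual weight into the duals of the given perfect matchings. -/
def MatchingDecomposition.dual (D : MatchingDecomposition W) (L : ℤ × ℤ) :
    MatchingDecomposition (dualWeight L W) where
  s := D.s
  pos i := dualWeight L (D.pos i)
  neg j := dualWeight L (D.neg j)
  pos_perfect i := (D.pos_perfect i).dualWeight L
  neg_perfect j := (D.neg_perfect j).dualWeight L
  eq_sub d := D.eq_sub (L - d)

end Decomposition

/-! ### Betti numbers -/

namespace KDiagram

variable {k : Type u} [Field k] (F : KDiagram k)

/-- The sections over `B₃` that agree on `A₁` with a section over `B₁`. -/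
def extendable₁ : Submodule k F.B₃ := (LinearMap.range F.ρ₁₁).comap F.ρ₃₁

/-- The sections over `B₃` that agree on `A₂` with a section over `B₂`. -/
def extendable₂ : Submodule k F.B₃ := (LinearMap.range F.ρ₂₂).comap F.ρ₃₂

theorem mem_range_differential {y : F.A₁ × F.A₂} :
    y ∈ LinearMap.range F.differential ↔
      ∃ b₁ b₂ b₃, F.ρ₁₁ b₁ - F.ρ₃₁ b₃ = y.1 ∧ F.ρ₂₂ b₂ - F.ρ₃₂ b₃ = y.2 :=
  ⟨fun ⟨b, hb⟩ => ⟨b.1, b.2.1, b.2.2, congrArg Prod.fst hb, congrArg Prod.snd hb⟩,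
    fun ⟨b₁, b₂, b₃, h₁, h₂⟩ => ⟨(b₁, b₂, b₃), Prod.ext h₁ h₂⟩⟩

theorem nonempty_H_zero_equiv (h₁ : Function.Injective F.ρ₁₁) (h₂ : Function.Injective F.ρ₂₂) :
    Nonempty (F.H 0 ≃ₗ[k] ↥(F.extendable₁ ⊓ F.extendable₂)) := by
  let restrict : LinearMap.ker F.differential →ₗ[k] F.B₃ :=
    LinearMap.snd k F.B₂ F.B₃ ∘ₗ LinearMap.snd k F.B₁ (F.B₂ × F.B₃) ∘ₗ Submodule.subtype _
  have hker (b : LinearMap.ker F.differential) :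
      F.ρ₁₁ b.1.1 = F.ρ₃₁ b.1.2.2 ∧ F.ρ₂₂ b.1.2.1 = F.ρ₃₂ b.1.2.2 :=
    ⟨sub_eq_zero.1 (congrArg Prod.fst b.2), sub_eq_zero.1 (congrArg Prod.snd b.2)⟩
  have hinj : Function.Injective restrict := fun b c hbc => by
    have h₃ : b.1.2.2 = c.1.2.2 := hbc
    refine Subtype.ext (Prod.ext (h₁ ?_) (Prod.ext (h₂ ?_) h₃))
    · rw [(hker b).1, (hker c).1, h₃]
    · rw [(hker b).2, (hker c).2, h₃]
  have hrange : LinearMap.range restrict = F.extendable₁ ⊓ F.extendable₂ := by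
    ext b₃
    constructor
    · rintro ⟨b, rfl⟩
      exact ⟨⟨_, (hker b).1⟩, ⟨_, (hker b).2⟩⟩
    · rintro ⟨⟨b₁, hb₁⟩, ⟨b₂, hb₂⟩⟩
      exact ⟨⟨(b₁, b₂, b₃), Prod.ext (sub_eq_zero.2 hb₁) (sub_eq_zero.2 hb₂)⟩, rfl⟩
  exact ⟨(LinearEquiv.ofInjective restrict hinj).trans (LinearEquiv.ofEq _ _ hrange)⟩

theorem inr_mem_range_differential_iff (x : F.B₃) :
    (0, F.ρ₃₂ x) ∈ LinearMap.range F.differential ↔ x ∈ F.extendable₁ ⊔ F.extendable₂ := by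
  rw [mem_range_differential, Submodule.mem_sup]
  constructor
  · rintro ⟨b₁, b₂, b₃, h₁, h₂⟩
    refine ⟨-b₃, neg_mem ⟨b₁, sub_eq_zero.1 h₁⟩, b₃ + x, ⟨b₂, ?_⟩, neg_add_cancel_left b₃ x⟩
    rw [map_add, ← sub_eq_iff_eq_add']
    exact h₂
  · rintro ⟨y, ⟨b₁, hb₁⟩, z, ⟨b₂, hb₂⟩, rfl⟩
    refine ⟨-b₁, b₂, -y, ?_, ?_⟩
    · rw [map_neg, map_neg, hb₁, sub_self]
    · rw [map_neg, map_add, hb₂, sub_neg_eq_add, add_comm]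

theorem nonempty_H_one_equiv (h₁ : Function.Surjective F.ρ₃₁) (h₂ : Function.Surjective F.ρ₃₂) :
    Nonempty (F.H 1 ≃ₗ[k] F.B₃ ⧸ F.extendable₁ ⊔ F.extendable₂) := by
  let connect : F.B₃ →ₗ[k] (F.A₁ × F.A₂) ⧸ LinearMap.range F.differential :=
    Submodule.mkQ _ ∘ₗ LinearMap.inr k F.A₁ F.A₂ ∘ₗ F.ρ₃₂
  have hker : LinearMap.ker connect = F.extendable₁ ⊔ F.extendable₂ := by
    ext x
    rw [← inr_mem_range_differential_iff]
    exact Submodule.Quotient.mk_eq_zero _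
  have hsurj : Function.Surjective connect := fun y => by
    obtain ⟨⟨y₁, y₂⟩, rfl⟩ := Submodule.mkQ_surjective _ y
    obtain ⟨b, rfl⟩ := h₁ y₁
    obtain ⟨x, hx⟩ := h₂ (y₂ - F.ρ₃₂ b)
    refine ⟨x, (Submodule.Quotient.eq _).2 (F.mem_range_differential.2 ⟨0, 0, b, ?_, ?_⟩)⟩
    · rw [map_zero]
      rfl
    · rw [map_zero, zero_sub]
      change _ = F.ρ₃₂ x - y₂
      rw [hx, sub_sub_cancel_left]
  exact ⟨((Submodule.quotEquivOfEq _ _ hker.symm).trans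
    (connect.quotKerEquivOfSurjective hsurj)).symm⟩

end KDiagram

section Betti

open Finsupp

variable {α β R M : Type*} [Semiring R] [AddCommMonoid M] [Module R M]

theorem range_lmapDomain_eq_supported (f : α → β) :
    LinearMap.range (lmapDomain M R f) = supported M R (Set.range f) := by
  rw [LinearMap.range_eq_map, ← supported_univ, lmapDomain_supported, Set.image_univ]

theorem comap_lmapDomain_supported {f : α → β} (hf : Function.Injective f) (s : Set β) :
    (supported M R s).comap (lmapDomain M R f) = supported M R (f ⁻¹' s) := by
  refine le_antisymm (fun x hx => (mem_supported' R x).2 fun a ha => ?_)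
    (supported_comap_lmapDomain M R f s)
  rw [← mapDomain_apply hf x a]
  exact (mem_supported' R _).1 hx _ ha

theorem finrank_supported [StrongRankCondition R] (s : Set α) :
    Module.finrank R (supported R R s) = Nat.card s := by
  rw [(supportedEquivFinsupp s).finrank_eq, Module.finrank_eq_nat_card_basis Finsupp.basisSingleOne]

theorem finrank_quotient_supported {R : Type*} [Ring R] [StrongRankCondition R] (s : Set α) :
    Module.finrank R ((α →₀ R) ⧸ supported R R s) = Nat.card ↥sᶜ := by
  have hcompl : IsCompl (supported R R s) (supported R R sᶜ) :=
    ⟨disjoint_supported_supported disjoint_compl_right,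
      codisjoint_supported_supported isCompl_compl.codisjoint⟩
  rw [(Submodule.quotientEquivOfIsCompl _ _ hcompl).finrank_eq, finrank_supported]

variable {k : Type u} [Field k] {W : ℤ × ℤ → ℤ}

theorem extendable₁_diagramM (d : ℤ × ℤ) (h₁ : Function.Injective fun p : Multi W => p.1.1.1) :
    (diagramM k W d).extendable₁ = supported k k {p : Multi W | p.1.1.1 ≤ d.1} := by
  have hrange : LinearMap.range (diagramM k W d).ρ₁₁ = supported k k {n | n ≤ d.1} :=
    (range_lmapDomain_eq_supported _).trans (congrArg _ Subtype.range_coe)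
  rw [KDiagram.extendable₁, hrange]
  exact comap_lmapDomain_supported h₁ _

theorem extendable₂_diagramM (d : ℤ × ℤ) (h₂ : Function.Injective fun p : Multi W => p.1.1.2) :
    (diagramM k W d).extendable₂ = supported k k {p : Multi W | p.1.1.2 ≤ d.2} := by
  have hrange : LinearMap.range (diagramM k W d).ρ₂₂ = supported k k {n | n ≤ d.2} :=
    (range_lmapDomain_eq_supported _).trans (congrArg _ Subtype.range_coe)
  rw [KDiagram.extendable₂, hrange]
  exact comap_lmapDomain_supported h₂ _

theorem finrank_H_zero_diagramM (d : ℤ × ℤ) (h₁ : Function.Injective fun p : Multi W => p.1.1.1)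
    (h₂ : Function.Injective fun p : Multi W => p.1.1.2) :
    Module.finrank k ((diagramM k W d).H 0) = Nat.card {p : Multi W // p.1.1 ∈ Set.Iic d} := by
  obtain ⟨e⟩ := (diagramM k W d).nonempty_H_zero_equiv
    (mapDomain_injective Subtype.val_injective) (mapDomain_injective Subtype.val_injective)
  have hinf : (diagramM k W d).extendable₁ ⊓ (diagramM k W d).extendable₂ =
      supported k k {p : Multi W | p.1.1 ∈ Set.Iic d} :=
    (congrArg₂ _ (extendable₁_diagramM d h₁) (extendable₂_diagramM d h₂)).trans
      (supported_inter _ _).symm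
  rw [e.finrank_eq, hinf]
  exact finrank_supported _

theorem finrank_H_one_diagramM (d : ℤ × ℤ) (h₁ : Function.Bijective fun p : Multi W => p.1.1.1)
    (h₂ : Function.Bijective fun p : Multi W => p.1.1.2) :
    Module.finrank k ((diagramM k W d).H 1) =
      Nat.card {p : Multi W // p.1.1 ∈ Set.Ici (d + 1)} := by
  obtain ⟨e⟩ := (diagramM k W d).nonempty_H_one_equiv
    (mapDomain_surjective h₁.2) (mapDomain_surjective h₂.2)
  have hIci (p : Multi W) :
      p ∈ ({p | p.1.1.1 ≤ d.1} ∪ {p | p.1.1.2 ≤ d.2} : Set (Multi W))ᶜ ↔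
        p.1.1 ∈ Set.Ici (d + 1) := by
    rw [Set.compl_union]
    exact and_congr (not_le.trans Int.add_one_le_iff.symm) (not_le.trans Int.add_one_le_iff.symm)
  have hsup : (diagramM k W d).extendable₁ ⊔ (diagramM k W d).extendable₂ =
      supported k k ({p | p.1.1.1 ≤ d.1} ∪ {p | p.1.1.2 ≤ d.2} : Set (Multi W)) :=
    (congrArg₂ _ (extendable₁_diagramM d h₁.1) (extendable₂_diagramM d h₂.1)).trans
      (supported_union _ _).symm
  rw [e.finrank_eq, hsup, ← Nat.card_congr (Equiv.subtypeEquivRight hIci)]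
  exact finrank_quotient_supported _

theorem card_multi_eq_finsum (hW : 0 ≤ W) {S : Set (ℤ × ℤ)}
    (hS : (S ∩ Function.support W).Finite) :
    (Nat.card {p : Multi W // p.1.1 ∈ S} : ℤ) = ∑ᶠ a ∈ S, W a := by
  have := hS.fintype
  let e : {p : Multi W // p.1.1 ∈ S} ≃
      Σ a : ↥(S ∩ Function.support W), Finset.Icc 1 (W a).toNat :=
    { toFun p := ⟨⟨p.1.1.1, p.2, (zero_lt_one.trans_le
          ((Nat.one_le_cast.2 p.1.2.1).trans p.1.2.2)).ne'⟩,
        ⟨p.1.1.2, Finset.mem_Icc.2 ⟨p.1.2.1, (Int.le_toNat (hW _)).2 p.1.2.2⟩⟩⟩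
      invFun q := ⟨⟨(q.1, q.2), (Finset.mem_Icc.1 q.2.2).1,
        (Int.le_toNat (hW _)).1 (Finset.mem_Icc.1 q.2.2).2⟩, q.1.2.1⟩ }
  calc (Nat.card {p : Multi W // p.1.1 ∈ S} : ℤ)
      = ∑ a : ↥(S ∩ Function.support W), ((W a).toNat : ℤ) := by
        rw [Nat.card_congr e, Nat.card_sigma, Nat.cast_sum]
        simp only [Nat.card_eq_fintype_card, Fintype.card_coe, Nat.card_Icc, add_tsub_cancel_right]
    _ = ∑ a : ↥(S ∩ Function.support W), W a :=
        Finset.sum_congr rfl fun a _ => Int.toNat_of_nonneg (hW a)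
    _ = ∑ᶠ a ∈ S, W a := by
        rw [← finsum_mem_inter_support, ← finsum_set_coe_eq_finsum_mem, finsum_eq_sum_of_fintype]

theorem IsPerfectMatching.nonneg (hW : IsPerfectMatching W) : 0 ≤ W := by
  obtain ⟨_, _, π, hπ⟩ := hW
  rintro ⟨i, j⟩
  rw [hπ, Pi.zero_apply]
  split_ifs <;> norm_num

theorem IsPerfectMatching.exists_equiv_multi (hW : IsPerfectMatching W) :
    ∃ (π : Equiv.Perm ℤ) (e : ℤ ≃ Multi W), ∀ i, (e i).1.1 = (i, π i) := by
  obtain ⟨_, _, π, hπ⟩ := hW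
  refine ⟨π, ⟨fun i => ⟨((i, π i), 1), le_rfl, by simp [hπ]⟩, fun p => p.1.1.1, fun _ => rfl,
    ?_⟩, fun _ => rfl⟩
  rintro ⟨⟨⟨i, j⟩, n⟩, hn, hnW⟩
  dsimp only at hn hnW
  rw [hπ] at hnW
  split_ifs at hnW with hj
  · obtain rfl : n = 1 := by omega
    simp [hj]
  · omega

theorem IsPerfectMatching.bijective_fst (hW : IsPerfectMatching W) :
    Function.Bijective fun p : Multi W => p.1.1.1 := by
  obtain ⟨π, e, he⟩ := hW.exists_equiv_multi
  convert e.symm.bijective using 2 with p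
  simpa using congrArg Prod.fst (he (e.symm p))

theorem IsPerfectMatching.bijective_snd (hW : IsPerfectMatching W) :
    Function.Bijective fun p : Multi W => p.1.1.2 := by
  obtain ⟨π, e, he⟩ := hW.exists_equiv_multi
  convert (e.symm.trans π).bijective using 2 with p
  simpa using congrArg Prod.snd (he (e.symm p))

/-- The set of degrees over which `W` is summed to give the `i`-th Betti number of `M_{W,d}`. -/
def bettiRegion (d : ℤ × ℤ) : Fin 2 → Set (ℤ × ℤ)
  | 0 => Set.Iic d
  | 1 => Set.Ici (d + 1)

theorem IsPerfectMatching.finite_bettiRegion_inter_support (hW : IsPerfectMatching W) (d : ℤ × ℤ)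
    (i : Fin 2) : (bettiRegion d i ∩ Function.support W).Finite :=
  match i with
  | 0 => hW.1.finite_Iic_inter_support d
  | 1 => hW.2.1.finite_Ici_inter_support (d + 1)

theorem IsPerfectMatching.finrank_H (hW : IsPerfectMatching W) (d : ℤ × ℤ) (i : Fin 2) :
    (Module.finrank k ((diagramM k W d).H i) : ℤ) = ∑ᶠ a ∈ bettiRegion d i, W a := by
  rw [← card_multi_eq_finsum hW.nonneg (hW.finite_bettiRegion_inter_support d i)]
  match i with
  | 0 => exact congrArg _ (finrank_H_zero_diagramM d hW.bijective_fst.1 hW.bijective_snd.1)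
  | 1 => exact congrArg _ (finrank_H_one_diagramM d hW.bijective_fst hW.bijective_snd)

end Betti

section Dimension

open Algebra

theorem grothendieck_lift_of {M G : Type*} [AddCommMonoid M] [AddCommGroup G] (f : M →+ G) (x : M) :
    GrothendieckAddGroup.lift f (GrothendieckAddGroup.of x) = f x :=
  DFunLike.congr_fun (GrothendieckAddGroup.lift.symm_apply_apply f) x

theorem grothendieck_exists_eq_sub {M : Type*} [AddCommMonoid M] (x : GrothendieckAddGroup M) :
    ∃ a b : M, x = GrothendieckAddGroup.of a - GrothendieckAddGroup.of b := by
  obtain ⟨⟨a, b⟩, h⟩ := (AddLocalization.addMonoidOf (⊤ : AddSubmonoid M)).surj x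
  exact ⟨a, b, eq_sub_of_add_eq h⟩

theorem grothendieck_lift_injective {M G : Type*} [AddCommMonoid M] [AddCommGroup G] {f : M →+ G}
    (hf : Function.Injective f) : Function.Injective (GrothendieckAddGroup.lift f) := by
  refine (injective_iff_map_eq_zero _).2 fun x hx => ?_
  obtain ⟨a, b, rfl⟩ := grothendieck_exists_eq_sub x
  rw [map_sub, grothendieck_lift_of, grothendieck_lift_of, sub_eq_zero] at hx
  rw [hf hx, sub_self]

variable {k : Type u} [Field k]

/-- The dimension of an isomorphism class of finite-dimensional vector spaces, as a homomorphism.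
It takes values in `ℤ` so that it extends to virtual vector spaces. -/
noncomputable def VecClass.dim : VecClass k →+ ℤ where
  toFun := Quotient.lift (fun V => (Module.finrank k V : ℤ))
    (fun _ _ ⟨e⟩ => congrArg _ e.finrank_eq)
  map_zero' := congrArg Nat.cast (Module.finrank_zero_of_subsingleton (R := k) (M := PUnit.{u + 1}))
  map_add' := by
    rintro ⟨V⟩ ⟨W⟩
    exact (congrArg Nat.cast (Module.finrank_prod (R := k) (M := V) (M' := W))).trans
      (Nat.cast_add _ _)

theorem VecClass.dim_injective : Function.Injective (VecClass.dim (k := k)) := by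
  rintro ⟨V⟩ ⟨W⟩ h
  exact Quotient.sound ⟨LinearEquiv.ofFinrankEq V W (Nat.cast_injective (R := ℤ) h)⟩

theorem VecClass.dim_dual (x : VecClass k) : VecClass.dim (VecClass.dual x) = VecClass.dim x := by
  obtain ⟨V⟩ := x
  exact congrArg Nat.cast (Subspace.dual_finrank_eq (K := k) (V := V))

/-- The dimension of a virtual vector space: `dim (V₁ ⊖ V₂) = dim V₁ - dim V₂`. -/
noncomputable def VirtualSpace.dim : VirtualSpace k →+ ℤ :=
  GrothendieckAddGroup.lift VecClass.dim

theorem VirtualSpace.dim_of (x : VecClass k) :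
    VirtualSpace.dim (GrothendieckAddGroup.of x) = VecClass.dim x :=
  grothendieck_lift_of _ x

theorem VirtualSpace.dim_injective : Function.Injective (VirtualSpace.dim (k := k)) :=
  grothendieck_lift_injective VecClass.dim_injective

theorem VirtualSpace.dim_dual (x : VirtualSpace k) :
    VirtualSpace.dim (VirtualSpace.dual x) = VirtualSpace.dim x := by
  obtain ⟨a, b, rfl⟩ := grothendieck_exists_eq_sub x
  have hof (y : VecClass k) : VirtualSpace.dim (VirtualSpace.dual (GrothendieckAddGroup.of y)) =
      VirtualSpace.dim (GrothendieckAddGroup.of y) := by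
    rw [VirtualSpace.dual, grothendieck_lift_of, AddMonoidHom.comp_apply, dim_of, dim_of,
      VecClass.dim_dual]
  rw [map_sub, map_sub, map_sub, hof, hof]

theorem VirtualDiagram.dim_H_of (i : Fin 2) (x : DiagramClass k) :
    VirtualSpace.dim (VirtualDiagram.H i (GrothendieckAddGroup.of x)) =
      VecClass.dim (DiagramClass.H i x) := by
  rw [VirtualDiagram.H, grothendieck_lift_of, AddMonoidHom.comp_apply, VirtualSpace.dim_of]

end Dimension

section BettiNumbers

variable {ι α M : Type*}

theorem finite_inter_support_sum [AddCommMonoid M] (t : Finset ι) {s : Set α} {g : ι → α → M}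
    (hg : ∀ n ∈ t, (s ∩ Function.support (g n)).Finite) :
    (s ∩ Function.support (∑ n ∈ t, g n)).Finite := by
  refine (t.finite_toSet.biUnion hg).subset fun a ⟨has, ha⟩ => ?_
  rw [Function.mem_support, Finset.sum_apply] at ha
  obtain ⟨n, hn, hna⟩ := Finset.exists_ne_zero_of_sum_ne_zero ha
  exact Set.mem_biUnion (Finset.mem_coe.2 hn) ⟨has, hna⟩

theorem finsum_mem_sum_comm [AddCommMonoid M] (t : Finset ι) {s : Set α} {g : ι → α → M}
    (hg : ∀ n ∈ t, (s ∩ Function.support (g n)).Finite) :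
    ∑ᶠ a ∈ s, (∑ n ∈ t, g n) a = ∑ n ∈ t, ∑ᶠ a ∈ s, g n a := by
  simp only [← Set.support_indicator] at hg
  simp only [finsum_mem_def, Finset.indicator_sum]
  simp only [Finset.sum_apply]
  exact finsum_sum_comm t (fun a n => s.indicator (g n) a) hg

theorem finsum_mem_sub_distrib_of_finite_support [AddCommGroup M] {s : Set α} {g h : α → M}
    (hg : (s ∩ Function.support g).Finite) (hh : (s ∩ Function.support h).Finite) :
    ∑ᶠ a ∈ s, (g - h) a = ∑ᶠ a ∈ s, g a - ∑ᶠ a ∈ s, h a := by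
  rw [← Set.support_indicator] at hg hh
  simp only [finsum_mem_def, Pi.sub_apply, Set.indicator_sub]
  exact finsum_sub_distrib hg hh

variable {W : ℤ × ℤ → ℤ}

theorem MatchingDecomposition.finsum_mem_bettiRegion (D : MatchingDecomposition W) (d : ℤ × ℤ)
    (i : Fin 2) :
    ∑ᶠ a ∈ bettiRegion d i, W a =
      ∑ n, ∑ᶠ a ∈ bettiRegion d i, D.pos n a - ∑ n, ∑ᶠ a ∈ bettiRegion d i, D.neg n a := by
  have hW : W = ∑ n, D.pos n - ∑ n, D.neg n := funext fun a => by
    rw [D.eq_sub, Pi.sub_apply, Finset.sum_apply, Finset.sum_apply]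
  have hpos n (_ : n ∈ Finset.univ) :=
    (D.pos_perfect n).finite_bettiRegion_inter_support d i
  have hneg n (_ : n ∈ Finset.univ) :=
    (D.neg_perfect n).finite_bettiRegion_inter_support d i
  rw [← finsum_mem_sum_comm _ hpos, ← finsum_mem_sum_comm _ hneg,
    ← finsum_mem_sub_distrib_of_finite_support (finite_inter_support_sum _ hpos)
      (finite_inter_support_sum _ hneg), ← hW]

variable {k : Type u} [Field k]

theorem IsPerfectMatching.dim_H_matchingClass (hW : IsPerfectMatching W) (d : ℤ × ℤ) (i : Fin 2) :
    VecClass.dim (DiagramClass.H i (matchingClass k hW d)) = ∑ᶠ a ∈ bettiRegion d i, W a :=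
  hW.finrank_H d i

theorem MatchingDecomposition.dim_H_virtualDiagram (D : MatchingDecomposition W) (d : ℤ × ℤ)
    (i : Fin 2) :
    VirtualSpace.dim (VirtualDiagram.H i (D.virtualDiagram k d)) =
      ∑ᶠ a ∈ bettiRegion d i, W a := by
  rw [virtualDiagram, map_sub, map_sub, VirtualDiagram.dim_H_of, VirtualDiagram.dim_H_of,
    map_sum, map_sum, map_sum, map_sum, D.finsum_mem_bettiRegion]
  simp only [IsPerfectMatching.dim_H_matchingClass]

theorem mem_bettiRegion_sub (d K a : ℤ × ℤ) (i : Fin 2) :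
    a ∈ bettiRegion (K - d) (1 - i) ↔ K + 1 - a ∈ bettiRegion d i := by
  match i with
  | 0 =>
    change K - d + 1 ≤ a ↔ K + 1 - a ≤ d
    rw [sub_le_comm, sub_add_eq_add_sub]
  | 1 =>
    change a ≤ K - d ↔ d + 1 ≤ K + 1 - a
    rw [le_sub_comm, le_sub_iff_add_le, le_sub_iff_add_le, add_right_comm, add_le_add_iff_right]

theorem finsum_bettiRegion_dualWeight (W : ℤ × ℤ → ℤ) (d K : ℤ × ℤ) (i : Fin 2) :
    ∑ᶠ a ∈ bettiRegion (K - d) (1 - i), dualWeight (K + 1) W a = ∑ᶠ a ∈ bettiRegion d i, W a := by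
  have hregion : bettiRegion (K - d) (1 - i) = Equiv.subLeft (K + 1) ⁻¹' bettiRegion d i :=
    Set.ext fun a => mem_bettiRegion_sub d K a i
  rw [hregion]
  exact finsum_comp_equiv (Equiv.subLeft (K + 1)) (f := fun a => ∑ᶠ _ : a ∈ bettiRegion d i, W a)

end BettiNumbers

end RiemannDuality

theorem mainTheorem10 (k : Type u) [Field k] (f W : ℤ × ℤ → ℤ)
    (hf : RiemannDuality.IsRiemannFunction f) (hW : RiemannDuality.IsWeightOf W f)
    (d K L : ℤ × ℤ) (hL : L = K + 1) :
    ((∃ C : ℤ, ∀ a, |W a| ≤ C) →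
      Nonempty (RiemannDuality.MatchingDecomposition W) ∧
      Nonempty (RiemannDuality.MatchingDecomposition (RiemannDuality.dualWeight L W))) ∧
    ∀ (D : RiemannDuality.MatchingDecomposition W)
      (D' : RiemannDuality.MatchingDecomposition (RiemannDuality.dualWeight L W)) (i : Fin 2),
      RiemannDuality.VirtualSpace.dual
          (RiemannDuality.VirtualDiagram.H i (D.virtualDiagram k d)) =
        RiemannDuality.VirtualDiagram.H (1 - i) (D'.virtualDiagram k (K - d)) := by
  subst hL
  refine ⟨fun ⟨C, hC⟩ => ?_, fun D D' i => ?_⟩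
  · have hbdd : BddBelow (Set.range W) :=
      ⟨-C, Set.forall_mem_range.2 fun a => neg_le_of_abs_le (hC a)⟩
    obtain ⟨D⟩ := RiemannDuality.nonempty_matchingDecomposition hW.1 (hW.eventuallyZero hf) hbdd
      (hW.hasLineSum hf)
    exact ⟨⟨D⟩, ⟨D.dual (K + 1)⟩⟩
  · apply RiemannDuality.VirtualSpace.dim_injective
    rw [RiemannDuality.VirtualSpace.dim_dual, D.dim_H_virtualDiagram, D'.dim_H_virtualDiagram,
      RiemannDuality.finsum_bettiRegion_dualWeight]
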